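/- Let $K$ be an imaginary quadratic field and let $\mathcal{O}_K$ be its ring of integers. A set $\{a_1,a_2,\dots,a_m\}\subset\mathcal{O}_K\setminus\{0\}$ of $m$ distinct nonzero elements is called a Diophantine $m$-tuple in $\mathcal{O}_K$ with property $D(-1)$ if, for all $1\le i<j\le m$, there is $x_{ij}\in\mathcal{O}_K$ with $a_ia_j-1=x_{ij}^2$. Then for every integer $m>36$ there is no Diophantine $m$-tuple in $\mathcal{O}_K$ with property $D(-1)$. -/

import Mathlib

/-- The family `a₁, …, a_m` enumerates a Diophantine `m`-tuple in the commutative ring `R` with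
property `D(n)`: the `a_i` are pairwise distinct (they form a set of `m` elements), nonzero, and
`a_i a_j + n` is a square in `R` for all `i < j`. -/
structure IsDiophantineTuple {R : Type*} [CommRing R] (n : R) {m : ℕ} (a : Fin m → R) : Prop where
  injective : Function.Injective a
  ne_zero : ∀ i, a i ≠ 0
  isSquare : ∀ i j, i < j → IsSquare (a i * a j + n)

/-!
Embed `𝓞 K` in `ℂ`, where `‖x‖ ^ 2` is the norm of `x` and hence a natural number.

*Large elements.* If `a`, `b`, `c` have property `D(-1)`, the product of
`2abc - (a + b + c) ± 2 √(ab - 1) √(ac - 1) √(bc - 1)` is a quadratic form in `a`, `b`, `c`. It lies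
in `𝓞 K`, so that either it vanishes or both factors have absolute value at least `1`, which forces
`‖c‖ ≥ ‖a‖ ‖b‖`. Hence, ordered by size, the elements with `‖a‖ ^ 2 ≥ 7` grow like powers with
Fibonacci exponents. On the other hand, a quadruple `{a, b, c, d}` yields simultaneous
approximations with the common denominator `√(cd - 1)` to the roots of `1 - 1 / (ac)` and
`1 - 1 / (bc)`, and Hermite–Padé approximation to `(1 + α x) ^ (1 / 2)` shows that these cannot be
too good. This bounds `d` polynomially in terms of `b` and `c` and leaves room for `20` elements.

*Small elements.* The elements with `‖a‖ ^ 2 ≤ 6` lie in a set `{(t + v √(-D)) / 2}` with `D ≥ 3`,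
of which `16` satisfy `2 ≤ ‖a‖ ^ 2 ≤ 6`. If some element `u` is a unit, all the others are
determined by the root of `u a - 1`, whose norm is at most `3`; there are only `13` such roots.
-/

/-- A subring of `ℂ` whose distinct elements have distance at least `1`. -/
def IsOneSeparated (R : Subring ℂ) : Prop := ∀ y ∈ R, y ≠ 0 → 1 ≤ ‖y‖

/-! ### Hermite–Padé approximation to square roots -/

namespace HermitePade

open PowerSeries Finset

section Expansion

variable {F : Type*} [Field F]

/-- The Taylor expansion of a polynomial at `α`, in the local parameter `X = z - α`, as a formal
power series. -/
noncomputable def expandAt (α : F) : Polynomial F →ₐ[F] F⟦X⟧ :=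
  Polynomial.aeval (C α + X)

lemma expandAt_X (α : F) : expandAt α Polynomial.X = C α + X :=
  Polynomial.aeval_X _

lemma expandAt_C (α r : F) : expandAt α (Polynomial.C r) = C r :=
  Polynomial.aeval_C _ r

lemma expandAt_X_sub_C (α β : F) :
    expandAt α (Polynomial.X - Polynomial.C β) = C (α - β) + X := by
  rw [map_sub, expandAt_X, expandAt_C, map_sub]
  ring

lemma derivative_expandAt (α : F) (f : Polynomial F) :
    d⁄dX F (expandAt α f) = expandAt α (Polynomial.derivative f) := by
  rw [expandAt, Derivation.map_aeval]
  simp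

lemma coeff_expandAt_X_pow (α : F) (n h : ℕ) :
    coeff h (expandAt α (Polynomial.X ^ n)) = n.choose h * α ^ (n - h) := by
  have coeff_pow := Polynomial.coeff_X_add_C_pow α n h
  rw [← Polynomial.coeff_coe] at coeff_pow
  push_cast at coeff_pow
  rw [map_pow, expandAt_X, add_comm, coeff_pow, mul_comm]

lemma C_add_X_mul_inv {δ : F} (hδ : δ ≠ 0) : (C δ + X : F⟦X⟧) * (C δ + X)⁻¹ = 1 :=
  PowerSeries.mul_inv_cancel _ (by simpa using hδ)

lemma C_add_X_mul_inv_pow_succ {δ : F} (hδ : δ ≠ 0) (n : ℕ) :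
    (C δ + X : F⟦X⟧) * (C δ + X)⁻¹ ^ (n + 1) = (C δ + X)⁻¹ ^ n := by
  rw [pow_succ', ← mul_assoc, C_add_X_mul_inv hδ, one_mul]

lemma coeff_inv_C_add_X_pow_succ {δ : F} (hδ : δ ≠ 0) (n m : ℕ) :
    coeff m ((C δ + X : F⟦X⟧)⁻¹ ^ (n + 1))
      = (-1) ^ m * ((n + m).choose n : F) / δ ^ (n + 1 + m) := by
  have factor : (C δ + X : F⟦X⟧) = C δ * rescale (-δ⁻¹) (1 - X) := by
    rw [map_sub, map_one, rescale_X, mul_sub, mul_one, ← mul_assoc, ← map_mul]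
    simp [hδ]
  have geometric : rescale (-δ⁻¹) (1 - X : F⟦X⟧) ^ (n + 1)
      * rescale (-δ⁻¹) (mk fun m => ((n + m).choose n : F)) = 1 := by
    rw [← map_pow, ← map_mul, ← invOneSubPow_val_succ_eq_mk_add_choose, mul_comm,
      ← invOneSubPow_inv_eq_one_sub_pow, (invOneSubPow F (n + 1)).val_inv, map_one]
  have inverse : (C δ + X : F⟦X⟧)⁻¹ ^ (n + 1)
      = C (δ⁻¹ ^ (n + 1)) * rescale (-δ⁻¹) (mk fun m => ((n + m).choose n : F)) := by
    refine left_inv_eq_right_inv (a := (C δ + X : F⟦X⟧) ^ (n + 1)) ?_ ?_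
    · rw [← mul_pow, mul_comm, C_add_X_mul_inv hδ, one_pow]
    · rw [factor, mul_pow, mul_mul_mul_comm, geometric, ← map_pow, ← map_mul, ← mul_pow]
      simp [hδ]
  rw [inverse, coeff_C_mul, coeff_rescale, coeff_mk, neg_pow, pow_add δ, div_eq_mul_inv, mul_inv,
    inv_pow, inv_pow]
  ring

lemma coeff_X_mul_derivative_sub (W : F⟦X⟧) (k : ℕ) :
    coeff k (X * d⁄dX F W - C (k : F) * W) = 0 := by
  rw [map_sub, coeff_C_mul]
  rcases k with _ | k
  · simp
  · rw [coeff_succ_X_mul, coeff_derivative]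
    push_cast
    ring

lemma derivative_pow_of_mul_eq_one {B V : F⟦X⟧} (h : B * V = 1) (k : ℕ) :
    d⁄dX F (V ^ k) = -(C (k : F) * V ^ (k + 1) * d⁄dX F B) := by
  rw [derivative_pow, Derivation.leibniz_of_mul_eq_one _ (mul_comm B V ▸ h), map_natCast]
  rcases k with _ | k
  · simp
  · rw [Nat.add_sub_cancel, smul_eq_mul]
    ring

lemma prod_mul_prod_inv {ι : Type*} [Fintype ι] [DecidableEq ι] {a : ι → F}
    (ha : Function.Injective a) (j : ι) :
    (∏ l ∈ univ.erase j, (C (a j - a l) + X : F⟦X⟧))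
      * ∏ l ∈ univ.erase j, (C (a j - a l) + X)⁻¹ = 1 := by
  rw [← prod_mul_distrib]
  exact prod_eq_one fun l hl => C_add_X_mul_inv (sub_ne_zero.2 (ha.ne (ne_of_mem_erase hl).symm))

end Expansion

lemma exists_eq_add_single {ι : Type*} [DecidableEq ι] {n : ι → ℕ} {i : ι} (hi : n i ≠ 0) :
    ∃ n' : ι → ℕ, n = n' + Pi.single i 1 :=
  ⟨n - Pi.single i 1, (tsub_add_cancel_of_le <| update_le_iff.2
    ⟨Nat.one_le_iff_ne_zero.2 hi, fun _ _ => Nat.zero_le _⟩).symm⟩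

lemma sum_add_single {ι : Type*} [Fintype ι] [DecidableEq ι] (n : ι → ℕ) (i : ι) (c : ℕ) :
    ∑ j, (n + Pi.single i c : ι → ℕ) j = ∑ j, n j + c := by
  simp [sum_add_distrib]

lemma exists_ne_zero_of_sum_eq_succ {ι : Type*} [Fintype ι] {n : ι → ℕ} {s : ℕ}
    (hn : ∑ j, n j = s + 1) : ∃ i, n i ≠ 0 := by
  by_contra! h
  simp [h] at hn

section SumResidues

variable {ι F : Type*} [Fintype ι] [DecidableEq ι] [Field F]

/-- The residue at `a j` of the rational function `f(z) / ∏ l, (z - a l) ^ n l`. The factor `X`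
makes it vanish when `n j = 0`, in spite of the truncated subtraction `n j - 1`. -/
noncomputable def residue (a : ι → F) (n : ι → ℕ) (j : ι) : Polynomial F →ₗ[F] F :=
  coeff (n j) ∘ₗ LinearMap.mulLeft F (X * ∏ l ∈ univ.erase j, (C (a j - a l) + X)⁻¹ ^ n l)
    ∘ₗ (expandAt (a j)).toLinearMap

/-- The sum of the residues of `f(z) / ∏ l, (z - a l) ^ n l` at all its finite poles. -/
noncomputable def sumResidues (a : ι → F) (n : ι → ℕ) : Polynomial F →ₗ[F] F :=
  ∑ j, residue a n j

lemma residue_apply (a : ι → F) (n : ι → ℕ) (j : ι) (f : Polynomial F) :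
    residue a n j f = coeff (n j)
      (X * (∏ l ∈ univ.erase j, (C (a j - a l) + X)⁻¹ ^ n l) * expandAt (a j) f) := rfl

lemma sumResidues_apply (a : ι → F) (n : ι → ℕ) (f : Polynomial F) :
    sumResidues a n f = ∑ j, residue a n j f :=
  LinearMap.sum_apply _ _ _

lemma sumResidues_zero (a : ι → F) : sumResidues a 0 = 0 :=
  sum_eq_zero fun j _ => LinearMap.ext fun f => by
    rw [residue_apply, Pi.zero_apply, mul_assoc, coeff_zero_X_mul, LinearMap.zero_apply]

lemma sumResidues_single (a : ι → F) (i : ι) (m : ℕ) (f : Polynomial F) :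
    sumResidues a (Pi.single i (m + 1)) f = coeff m (expandAt (a i) f) := by
  rw [sumResidues_apply, sum_eq_single_of_mem i (mem_univ i)]
  · rw [residue_apply, Pi.single_eq_same, mul_assoc, coeff_succ_X_mul, prod_eq_one, one_mul]
    intro l hl
    rw [Pi.single_eq_of_ne (ne_of_mem_erase hl), pow_zero]
  · intro j _ hj
    rw [residue_apply, Pi.single_eq_of_ne hj, mul_assoc, coeff_zero_X_mul]

lemma residue_add_single {a : ι → F} (ha : Function.Injective a) (n : ι → ℕ) (i j : ι)
    (f : Polynomial F) :
    residue a (n + Pi.single i 1) j ((Polynomial.X - Polynomial.C (a i)) * f)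
      = residue a n j f := by
  rw [residue_apply, residue_apply, map_mul (expandAt _), expandAt_X_sub_C]
  rcases eq_or_ne j i with rfl | hj
  · have others : ∀ l ∈ univ.erase j, (C (a j - a l) + X : F⟦X⟧)⁻¹ ^ (n + Pi.single j 1 : ι → ℕ) l
        = (C (a j - a l) + X)⁻¹ ^ n l := fun l hl => by
      rw [Pi.add_apply, Pi.single_eq_of_ne (ne_of_mem_erase hl), add_zero]
    rw [prod_congr rfl others, Pi.add_apply, Pi.single_eq_same, sub_self, map_zero, zero_add,
      mul_assoc, coeff_succ_X_mul]
    congr 1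
    ring
  · have hi : i ∈ univ.erase j := mem_erase.2 ⟨hj.symm, mem_univ _⟩
    have others : ∀ l ∈ (univ.erase j).erase i,
        (C (a j - a l) + X : F⟦X⟧)⁻¹ ^ (n + Pi.single i 1 : ι → ℕ) l
          = (C (a j - a l) + X)⁻¹ ^ n l := fun l hl => by
      rw [Pi.add_apply, Pi.single_eq_of_ne (ne_of_mem_erase hl), add_zero]
    rw [← mul_prod_erase _ _ hi, ← mul_prod_erase _ _ hi, prod_congr rfl others, Pi.add_apply,
      Pi.add_apply, Pi.single_eq_same, Pi.single_eq_of_ne hj, add_zero,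
      ← C_add_X_mul_inv_pow_succ (sub_ne_zero.2 (ha.ne hj)) (n i)]
    congr 1
    ring

lemma sumResidues_add_single_X_mul {a : ι → F} (ha : Function.Injective a) (n : ι → ℕ) (i : ι)
    (f : Polynomial F) :
    sumResidues a (n + Pi.single i 1) (Polynomial.X * f)
      = a i * sumResidues a (n + Pi.single i 1) f + sumResidues a n f := by
  have split : (Polynomial.X : Polynomial F) * f
      = a i • f + (Polynomial.X - Polynomial.C (a i)) * f := by
    rw [Polynomial.smul_eq_C_mul]
    ring
  rw [split, map_add, map_smul, smul_eq_mul, sumResidues_apply a n,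
    sumResidues_apply a _ ((Polynomial.X - Polynomial.C (a i)) * f)]
  simp only [residue_add_single ha]

/-- The residue at infinity of `1 / ∏ l, (z - a l) ^ n l` vanishes once its degree is at most
`-2`. -/
lemma sumResidues_one {a : ι → F} (ha : Function.Injective a) {s : ℕ} {n : ι → ℕ}
    (hn : ∑ j, n j = s + 1) : sumResidues a n 1 = if s = 0 then 1 else 0 := by
  induction s generalizing n with
  | zero =>
    obtain ⟨i, hi⟩ := exists_ne_zero_of_sum_eq_succ hn
    obtain ⟨n, rfl⟩ := exists_eq_add_single hi
    rw [sum_add_single, add_left_inj] at hn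
    obtain rfl : n = 0 := funext fun j => (sum_eq_zero_iff.1 hn) j (mem_univ j)
    rw [zero_add, sumResidues_single, map_one, coeff_zero_one, if_pos rfl]
  | succ s ih =>
    obtain ⟨i, hi⟩ := exists_ne_zero_of_sum_eq_succ hn
    by_cases single : ∀ j ≠ i, n j = 0
    · obtain rfl : n = Pi.single i (s + 1 + 1) := by
        rw [← hn, sum_eq_single_of_mem i (mem_univ i) fun j _ => single j]
        refine funext fun j => ?_
        rcases eq_or_ne j i with rfl | hj
        · rw [Pi.single_eq_same]
        · rw [single j hj, Pi.single_eq_of_ne hj]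
      rw [sumResidues_single, map_one, coeff_one]
    · push Not at single
      obtain ⟨j, hji, hj⟩ := single
      obtain ⟨n₁, h₁⟩ := exists_eq_add_single hi
      obtain ⟨n₂, h₂⟩ := exists_eq_add_single hj
      have e₁ := sumResidues_add_single_X_mul ha n₁ i 1
      have e₂ := sumResidues_add_single_X_mul ha n₂ j 1
      have s₁ := hn
      have s₂ := hn
      rw [h₁, sum_add_single, add_left_inj] at s₁
      rw [h₂, sum_add_single, add_left_inj] at s₂
      rw [← h₁, ih s₁] at e₁
      rw [← h₂, ih s₂, e₁] at e₂
      have proportional : (a i - a j) * sumResidues a n 1 = 0 := by linear_combination e₂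
      rw [if_neg s.succ_ne_zero]
      exact (mul_eq_zero.1 proportional).resolve_left (sub_ne_zero.2 (ha.ne hji.symm))

end SumResidues

lemma norm_sumResidues_X_pow_le {ι F : Type*} [Fintype ι] [DecidableEq ι] [NormedField F]
    {a : ι → F} (ha : Function.Injective a) {M : ℝ} (hM : ∀ i, ‖a i‖ ≤ M) (m : ℕ) {n : ι → ℕ}
    {s : ℕ} (hn : ∑ j, n j = s + 1) :
    ‖sumResidues a n (Polynomial.X ^ m)‖ ≤ m.choose s * M ^ (m - s) := by
  induction m generalizing n s with
  | zero =>
    rw [pow_zero, sumResidues_one ha hn]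
    split_ifs with h <;> simp [h]
  | succ m ih =>
    obtain ⟨i, hi⟩ := exists_ne_zero_of_sum_eq_succ hn
    obtain ⟨n', hn'⟩ := exists_eq_add_single hi
    have recurrence := sumResidues_add_single_X_mul ha n' i (Polynomial.X ^ m)
    rw [← hn', ← pow_succ'] at recurrence
    have sum' : ∑ j, n' j = s := by rwa [hn', sum_add_single, add_left_inj] at hn
    have first : ‖a i * sumResidues a n (Polynomial.X ^ m)‖ ≤ m.choose s * M ^ (m + 1 - s) :=
      calc ‖a i * sumResidues a n (Polynomial.X ^ m)‖
          ≤ M * (m.choose s * M ^ (m - s)) := by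
            rw [norm_mul]
            exact mul_le_mul (hM i) (ih hn) (norm_nonneg _) ((norm_nonneg _).trans (hM i))
        _ = m.choose s * M ^ (m + 1 - s) := by
            rcases le_or_gt s m with hsm | hsm
            · rw [Nat.succ_sub hsm, pow_succ]
              ring
            · simp [Nat.choose_eq_zero_of_lt hsm]
    rw [recurrence]
    rcases s with _ | s
    · obtain rfl : n' = 0 := funext fun j => (sum_eq_zero_iff.1 sum') j (mem_univ j)
      simpa [sumResidues_zero] using first
    · calc _ ≤ m.choose (s + 1) * M ^ (m - s) + m.choose s * M ^ (m - s) :=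
            norm_add_le_of_le (by simpa using first) (ih sum')
        _ = (m + 1).choose (s + 1) * M ^ (m + 1 - (s + 1)) := by
            rw [Nat.choose_succ_succ, Nat.add_sub_add_right]
            push_cast
            ring

section HalfIntegerBinomials

lemma succ_mul_choose_succ {R : Type*} [CommRing R] [BinomialRing R] (r : R) (n : ℕ) :
    ((n : R) + 1) * Ring.choose r (n + 1) = (r - n) * Ring.choose r n := by
  have h := Ring.choose_smul_choose r (Nat.le_succ n)
  rw [Nat.succ_sub le_rfl, Nat.sub_self, Ring.choose_one_right, Nat.succ_eq_add_one,
    Nat.choose_succ_self_right, nsmul_eq_mul] at h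
  push_cast at h
  rw [h, mul_comm]

lemma choose_succ_sub_half_succ {F : Type*} [Field F] [CharZero F] (k n : ℕ) :
    Ring.choose (((k + 1 : ℕ) : F) - 1 / 2) (n + 1)
      = Ring.choose ((k : F) - 1 / 2) n + Ring.choose ((k : F) - 1 / 2) (n + 1) := by
  rw [← Ring.choose_succ_succ]
  congr 1
  push_cast
  ring

lemma four_pow_mul_choose_neg_half {F : Type*} [Field F] [CharZero F] (n : ℕ) :
    4 ^ n * Ring.choose (-1 / 2 : F) n = (-1) ^ n * (n.centralBinom : F) := by
  induction n with
  | zero => simp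
  | succ n ih =>
    have central : ((n : F) + 1) * ((n + 1).centralBinom : F)
        = 2 * (2 * n + 1) * (n.centralBinom : F) := by
      exact_mod_cast Nat.succ_mul_centralBinom_succ n
    apply mul_left_cancel₀ (Nat.cast_add_one_ne_zero n : (n : F) + 1 ≠ 0)
    linear_combination 4 ^ (n + 1) * succ_mul_choose_succ (-1 / 2 : F) n
      + 4 * (-1 / 2 - n) * ih - (-1) ^ (n + 1) * central

lemma exists_int_four_pow_mul_choose_sub_half {F : Type*} [Field F] [CharZero F] (k n : ℕ) :
    ∃ z : ℤ, 4 ^ n * Ring.choose ((k : F) - 1 / 2) n = z := by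
  induction k generalizing n with
  | zero =>
    refine ⟨(-1) ^ n * n.centralBinom, ?_⟩
    rw [Nat.cast_zero, zero_sub, ← neg_div, four_pow_mul_choose_neg_half]
    push_cast
    rfl
  | succ k ih =>
    rcases n with _ | n
    · exact ⟨1, by simp⟩
    · obtain ⟨y, hy⟩ := ih n
      obtain ⟨z, hz⟩ := ih (n + 1)
      refine ⟨4 * y + z, ?_⟩
      rw [choose_succ_sub_half_succ]
      push_cast
      rw [← hy, ← hz]
      ring

lemma norm_choose_neg_half_le (n : ℕ) : ‖Ring.choose (-1 / 2 : ℂ) n‖ ≤ 1 := by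
  have central := congrArg norm (four_pow_mul_choose_neg_half (F := ℂ) n)
  have bound : (n.centralBinom : ℝ) ≤ 4 ^ n := by
    exact_mod_cast (Nat.centralBinom_eq_two_mul_choose n).trans_le
      ((Nat.choose_le_two_pow _ _).trans_eq (by rw [pow_mul]; norm_num))
  simp only [norm_mul, norm_pow, norm_neg, norm_one, one_pow, one_mul, Complex.norm_natCast,
    Complex.norm_ofNat] at central
  exact le_of_mul_le_mul_left (by linarith) (by positivity : (0 : ℝ) < 4 ^ n)

lemma norm_choose_sub_half_le (k n : ℕ) : ‖Ring.choose ((k : ℂ) - 1 / 2) n‖ ≤ 2 ^ k := by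
  induction k generalizing n with
  | zero => simpa [neg_div] using norm_choose_neg_half_le n
  | succ k ih =>
    rcases n with _ | n
    · simpa using one_le_pow₀ (one_le_two : (1 : ℝ) ≤ 2)
    · rw [choose_succ_sub_half_succ, pow_succ, mul_two]
      exact norm_add_le_of_le (ih n) (ih (n + 1))

lemma natCast_add_half {F : Type*} [Field F] [CharZero F] (k : ℕ) :
    (k : F) + 1 / 2 = ((k + 1 : ℕ) : F) - 1 / 2 := by
  push_cast
  ring

lemma exists_int_four_pow_mul_choose_add_half {F : Type*} [Field F] [CharZero F] (k n : ℕ) :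
    ∃ z : ℤ, 4 ^ n * Ring.choose ((k : F) + 1 / 2) n = z := by
  rw [natCast_add_half]
  exact exists_int_four_pow_mul_choose_sub_half (k + 1) n

lemma norm_choose_add_half_le (k n : ℕ) :
    ‖Ring.choose ((k : ℂ) + 1 / 2) n‖ ≤ 2 ^ (k + 1) := by
  rw [natCast_add_half]
  exact norm_choose_sub_half_le (k + 1) n

end HalfIntegerBinomials

section ExactNumerator

variable {ι F : Type*} [Fintype ι] [Field F]

/-- The numerator of the derivative of `(1 + x z) ^ (k + 3/2) z ^ m / ∏ l, (z - a l) ^ k` over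
`(1 + x z) ^ (k + 1/2)` and the denominator `∏ l, (z - a l) ^ (k + 1)`. An exact form has no
residues, so all the Padé forms vanish on it. -/
noncomputable def exactNumerator (a : ι → F) (x : F) (k m : ℕ) : Polynomial F :=
  Polynomial.C (((k : F) + 3 / 2) * x) * Polynomial.X ^ m * ∏ l, (Polynomial.X - Polynomial.C (a l))
    + (1 + Polynomial.C x * Polynomial.X)
      * (Polynomial.derivative (Polynomial.X ^ m) * ∏ l, (Polynomial.X - Polynomial.C (a l))
        - Polynomial.C (k : F) * Polynomial.X ^ m
          * Polynomial.derivative (∏ l, (Polynomial.X - Polynomial.C (a l))))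

lemma coeff_exactNumerator (a : ι → F) (x : F) (k m i : ℕ) :
    (exactNumerator a x k m).coeff (m + i)
      = x * (k + 3 / 2 + m - k * i) * (∏ l, (Polynomial.X - Polynomial.C (a l))).coeff i
        + (m - k * (i + 1)) * (∏ l, (Polynomial.X - Polynomial.C (a l))).coeff (i + 1) := by
  set A := ∏ l, (Polynomial.X - Polynomial.C (a l))
  have derivative_X_pow : Polynomial.X * Polynomial.derivative (Polynomial.X ^ m : Polynomial F)
      = Polynomial.C (m : F) * Polynomial.X ^ m := by
    rcases m with _ | m
    · simp
    · rw [Polynomial.derivative_X_pow, Nat.add_sub_cancel]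
      ring
  have factor : Polynomial.X * exactNumerator a x k m
      = Polynomial.X ^ m * (Polynomial.C (((k : F) + 3 / 2) * x) * (Polynomial.X * A)
        + (Polynomial.C (m : F) * A
          - Polynomial.C (k : F) * (Polynomial.X * Polynomial.derivative A))
        + Polynomial.C x * (Polynomial.X * (Polynomial.C (m : F) * A
          - Polynomial.C (k : F) * (Polynomial.X * Polynomial.derivative A)))) := by
    rw [exactNumerator]
    linear_combination (1 + Polynomial.C x * Polynomial.X) * A * derivative_X_pow
  have coeff_X_mul_derivative : ∀ i, (Polynomial.X * Polynomial.derivative A).coeff i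
      = i * A.coeff i := fun i => by
    rcases i with _ | i
    · simp
    · rw [Polynomial.coeff_X_mul, Polynomial.coeff_derivative]
      push_cast
      ring
  rw [← Polynomial.coeff_X_mul, factor, add_comm m i, add_right_comm i,
    Polynomial.coeff_X_pow_mul]
  simp only [Polynomial.coeff_add, Polynomial.coeff_sub, Polynomial.coeff_C_mul,
    Polynomial.coeff_X_mul, coeff_X_mul_derivative]
  push_cast
  ring

lemma natDegree_prod_X_sub_C (a : ι → F) :
    (∏ l, (Polynomial.X - Polynomial.C (a l))).natDegree = Fintype.card ι := by
  rw [Polynomial.natDegree_finsetProd_X_sub_C_eq_card]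
  rfl

lemma natDegree_exactNumerator_le (a : ι → F) (x : F) (k m : ℕ) :
    (exactNumerator a x k m).natDegree ≤ m + Fintype.card ι := by
  refine Polynomial.natDegree_le_iff_coeff_eq_zero.2 fun N hN => ?_
  obtain ⟨i, rfl⟩ := Nat.exists_eq_add_of_le ((Nat.le_add_right m _).trans hN.le)
  have degree := natDegree_prod_X_sub_C a
  rw [coeff_exactNumerator, Polynomial.coeff_eq_zero_of_natDegree_lt (by omega),
    Polynomial.coeff_eq_zero_of_natDegree_lt (by omega), mul_zero, mul_zero, add_zero]

lemma coeff_exactNumerator_ne_zero [CharZero F] (a : ι → F) {x : F} (hx : x ≠ 0) (k m : ℕ) :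
    (exactNumerator a x k m).coeff (m + Fintype.card ι) ≠ 0 := by
  have degree := natDegree_prod_X_sub_C a
  have monic : (∏ l, (Polynomial.X - Polynomial.C (a l))).Monic :=
    Polynomial.monic_prod_X_sub_C a univ
  rw [coeff_exactNumerator, ← degree, monic.coeff_natDegree,
    Polynomial.coeff_eq_zero_of_natDegree_lt (Nat.lt_succ_self _), mul_zero, add_zero, mul_one]
  refine mul_ne_zero hx fun h => ?_
  have odd_eq_even : ((2 * (k + m) + 3 : ℕ) : F)
      = ((2 * (k * (∏ l, (Polynomial.X - Polynomial.C (a l))).natDegree) : ℕ) : F) := by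
    push_cast
    linear_combination 2 * h
  rw [Nat.cast_inj] at odd_eq_even
  omega

end ExactNumerator

/-- The triangular shape of the `P m` expresses every `X ^ n` through `X ^ g`, `g < r`. -/
lemma linearMap_eq_zero_of_triangular {F : Type*} [Field F] {r : ℕ} {P : ℕ → Polynomial F}
    (degree : ∀ m, (P m).natDegree ≤ m + r) (leading : ∀ m, (P m).coeff (m + r) ≠ 0)
    {Φ : Polynomial F →ₗ[F] F} (hP : ∀ m, Φ (P m) = 0)
    (low : ∀ g < r, Φ (Polynomial.X ^ g) = 0) : Φ = 0 := by
  have vanish : ∀ n, Φ (Polynomial.X ^ n) = 0 := fun n => by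
    induction n using Nat.strong_induction_on with
    | _ n ih =>
      rcases lt_or_ge n r with hn | hn
      · exact low n hn
      obtain ⟨m, rfl⟩ := Nat.exists_eq_add_of_le' hn
      have expansion := hP m
      rw [(P m).as_sum_range_C_mul_X_pow' (Nat.lt_succ_of_le (degree m)), map_sum, sum_range_succ,
        sum_eq_zero, zero_add, ← Polynomial.smul_eq_C_mul, map_smul] at expansion
      · exact (smul_eq_zero.1 expansion).resolve_left (leading m)
      · intro i hi
        rw [← Polynomial.smul_eq_C_mul, map_smul, ih i (mem_range.1 hi), smul_zero]
  refine Polynomial.lhom_ext' fun n => LinearMap.ext_ring ?_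
  simpa [Polynomial.monomial_one_right_eq_X_pow] using vanish n

section PadeForms

variable {ι F : Type*} [Fintype ι] [DecidableEq ι] [Field F] [CharZero F]

/-- The power series in `X = z - α` of `(1 + x z) ^ (k + 1/2) / e ^ (1/2)`, where `e = 1 + x α`,
so that `(1 + x z) = e + x X`. Dividing by the square root makes the coefficients rational. -/
noncomputable def halfPow (k : ℕ) (x e : F) : F⟦X⟧ :=
  mk fun h => Ring.choose ((k : F) + 1 / 2) h * x ^ h * e ^ ((k : ℤ) - h)

lemma linear_mul_derivative_halfPow (k : ℕ) (x : F) {e : F} (he : e ≠ 0) :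
    (C e + C x * X) * d⁄dX F (halfPow k x e) = C (((k : F) + 1 / 2) * x) * halfPow k x e := by
  have lower : ∀ h : ℕ, e * e ^ ((k : ℤ) - (h + 1 : ℕ)) = e ^ ((k : ℤ) - h) := fun h => by
    rw [← zpow_one_add₀ he]
    congr 1
    push_cast
    ring
  ext h
  have recurrence := succ_mul_choose_succ ((k : F) + 1 / 2) h
  have scale := lower h
  rw [add_mul, map_add, coeff_C_mul, mul_assoc, coeff_C_mul, coeff_C_mul, coeff_derivative]
  rcases h with _ | h
  · rw [coeff_zero_X_mul, halfPow, coeff_mk, coeff_mk, ← scale]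
    push_cast at recurrence ⊢
    simp only [zero_add] at recurrence ⊢
    linear_combination x * e * e ^ ((k : ℤ) - 1) * recurrence
  · rw [coeff_succ_X_mul, coeff_derivative, halfPow, coeff_mk, coeff_mk, ← scale]
    push_cast at recurrence scale ⊢
    linear_combination x ^ (h + 1 + 1) * e * e ^ ((k : ℤ) - (h + 1 + 1)) * recurrence

/-- The coefficient of `(1 + a j x) ^ (1/2)` in the Hermite–Padé form attached to the polynomial
`g`: up to that square root, the residue at `a j` of
`(1 + x z) ^ (k + 1/2) g(z) / ∏ l, (z - a l) ^ (k + 1)`. -/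
noncomputable def padeForm (a : ι → F) (x : F) (k : ℕ) (j : ι) : Polynomial F →ₗ[F] F :=
  coeff k ∘ₗ LinearMap.mulLeft F
      (halfPow k x (1 + a j * x) * ∏ l ∈ univ.erase j, (C (a j - a l) + X)⁻¹ ^ (k + 1))
    ∘ₗ (expandAt (a j)).toLinearMap

lemma padeForm_apply (a : ι → F) (x : F) (k : ℕ) (j : ι) (g : Polynomial F) :
    padeForm a x k j g = coeff k (halfPow k x (1 + a j * x)
      * (∏ l ∈ univ.erase j, (C (a j - a l) + X)⁻¹ ^ (k + 1)) * expandAt (a j) g) := rfl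

lemma padeForm_exactNumerator {a : ι → F} (ha : Function.Injective a) {x : F} {j : ι}
    (he : 1 + a j * x ≠ 0) (k m : ℕ) : padeForm a x k j (exactNumerator a x k m) = 0 := by
  set B : F⟦X⟧ := ∏ l ∈ univ.erase j, (C (a j - a l) + X)
  set V : F⟦X⟧ := ∏ l ∈ univ.erase j, (C (a j - a l) + X)⁻¹
  set U := halfPow k x (1 + a j * x)
  set L : F⟦X⟧ := C (1 + a j * x) + C x * X
  set Z := expandAt (a j) (Polynomial.X ^ m)
  have inverse : B * V = 1 := prod_mul_prod_inv ha j
  have expand_prod : expandAt (a j) (∏ l, (Polynomial.X - Polynomial.C (a l))) = X * B := by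
    simp only [map_prod, expandAt_X_sub_C]
    rw [← mul_prod_erase _ _ (mem_univ j), sub_self, map_zero, zero_add]
  have expand_linear : expandAt (a j) (1 + Polynomial.C x * Polynomial.X) = L := by
    simp only [map_add, map_one, map_mul, expandAt_C, expandAt_X, L]
    ring
  have differential : L * d⁄dX F U = C (((k : F) + 1 / 2) * x) * U :=
    linear_mul_derivative_halfPow k x he
  have split : C (((k : F) + 3 / 2) * x) = C (((k : F) + 1 / 2) * x) + C x := by
    rw [← map_add]
    congr 1
    ring
  have expand_exact : expandAt (a j) (exactNumerator a x k m)
      = C (((k : F) + 3 / 2) * x) * Z * (X * B)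
        + L * (d⁄dX F Z * (X * B) - C (k : F) * Z * d⁄dX F (X * B)) := by
    rw [exactNumerator, map_add]
    simp only [map_mul (expandAt (a j)), map_sub (expandAt (a j)), ← derivative_expandAt,
      expand_linear, expand_prod, expandAt_C, Z]
  rw [padeForm_apply, ← coeff_X_mul_derivative_sub (L * U * Z * V ^ k) k, prod_pow, expand_exact,
    split]
  congr 1
  simp only [Derivation.leibniz, smul_eq_mul, derivative_pow_of_mul_eq_one inverse, derivative_X,
    map_add (d⁄dX F), derivative_C, L]
  linear_combination (U * V ^ k * ((C (((k : F) + 1 / 2) * x) + C x) * Z * X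
    + L * d⁄dX F Z * X - C (k : F) * L * Z)) * inverse - X * Z * V ^ k * differential

/-- The numerator of `(1 + x z) ^ (k + 1/2) / (z - a j)`, whose only residue is at `a j`. -/
lemma exists_forall_padeForm_eq {a : ι → F} (ha : Function.Injective a) (x : F) (k : ℕ) (j : ι) :
    ∃ g, ∀ i, padeForm a x k i g = if i = j then (1 + a j * x) ^ k else 0 := by
  refine ⟨(Polynomial.X - Polynomial.C (a j)) ^ k
    * ∏ l ∈ univ.erase j, (Polynomial.X - Polynomial.C (a l)) ^ (k + 1), fun i => ?_⟩
  rw [padeForm_apply, map_mul (expandAt _), map_prod]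
  simp only [map_pow, expandAt_X_sub_C]
  split_ifs with hij
  · have inverse : (∏ l ∈ univ.erase j, (C (a j - a l) + X : F⟦X⟧) ^ (k + 1))
        * ∏ l ∈ univ.erase j, (C (a j - a l) + X)⁻¹ ^ (k + 1) = 1 := by
      rw [prod_pow, prod_pow, ← mul_pow, prod_mul_prod_inv ha, one_pow]
    rw [hij, sub_self, map_zero, zero_add, mul_mul_mul_comm, mul_comm (∏ _ ∈ _, _), inverse,
      mul_one, coeff_mul_X_pow', if_pos le_rfl, Nat.sub_self, halfPow, coeff_mk]
    simp
  · rw [← mul_prod_erase _ _ (mem_erase.2 ⟨hij, mem_univ i⟩), sub_self, map_zero, zero_add]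
    refine X_pow_dvd_iff.1 ?_ k (Nat.lt_succ_self k)
    exact ((Dvd.intro _ rfl).mul_left _).mul_left _

lemma eq_zero_of_sum_padeForm_eq_zero {a : ι → F} (ha : Function.Injective a) {x : F} (hx : x ≠ 0)
    (he : ∀ j, 1 + a j * x ≠ 0) (k : ℕ) {v : ι → F}
    (h : ∀ g < Fintype.card ι, ∑ j, v j * padeForm a x k j (Polynomial.X ^ g) = 0) : v = 0 := by
  have combination : ∑ j, v j • padeForm a x k j = 0 :=
    linearMap_eq_zero_of_triangular (natDegree_exactNumerator_le a x k)
      (coeff_exactNumerator_ne_zero a hx k)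
      (fun m => by simp [LinearMap.sum_apply, padeForm_exactNumerator ha (he _)])
      (fun g hg => by simpa [LinearMap.sum_apply] using h g hg)
  refine funext fun j => ?_
  obtain ⟨g, hg⟩ := exists_forall_padeForm_eq ha x k j
  have evaluate := LinearMap.congr_fun combination g
  simpa [LinearMap.sum_apply, hg, he j] using evaluate

end PadeForms

section Smallness

lemma hasSum_choose_mul_pow {y : ℂ} (hy : ‖y‖ < 1) (r : ℂ) :
    HasSum (fun n : ℕ => Ring.choose r n * y ^ n) ((1 + y) ^ r) := by
  have series := (Complex.one_add_cpow_hasFPowerSeriesOnBall_zero (a := r)).hasSum (y := y) (by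
    rw [Metric.mem_eball, edist_zero_right, ← ofReal_norm]
    exact ENNReal.ofReal_lt_one.2 hy)
  simpa only [binomialSeries_apply, zero_add, List.ofFn_const, List.prod_replicate,
    smul_eq_mul] using series

lemma one_add_ne_zero_of_norm_lt_one {y : ℂ} (hy : ‖y‖ < 1) : 1 + y ≠ 0 := fun h => by
  rw [eq_neg_of_add_eq_zero_right h, norm_neg, norm_one] at hy
  exact lt_irrefl _ hy

lemma sqrt_mul_coeff_halfPow (k h : ℕ) (x : ℂ) {e : ℂ} (he : e ≠ 0) :
    e ^ (1 / 2 : ℂ) * coeff h (halfPow k x e)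
      = Ring.choose ((k : ℂ) + 1 / 2) h * x ^ h * e ^ ((k : ℂ) + 1 / 2 - h) := by
  have exponent : e ^ ((k : ℂ) + 1 / 2 - h) = e ^ (1 / 2 : ℂ) * e ^ ((k : ℤ) - h) := by
    rw [← Complex.cpow_intCast, ← Complex.cpow_add _ _ he]
    congr 1
    push_cast
    ring
  rw [halfPow, coeff_mk, exponent]
  ring

lemma hasSum_choose_mul_coeff_expandAt {α x : ℂ} (hy : ‖α * x‖ < 1) (k h : ℕ) :
    HasSum (fun n : ℕ => Ring.choose ((k : ℂ) + 1 / 2) n * x ^ n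
        * coeff h (expandAt α (Polynomial.X ^ n)))
      ((1 + α * x) ^ (1 / 2 : ℂ) * coeff h (halfPow k x (1 + α * x))) := by
  set r : ℂ := (k : ℂ) + 1 / 2
  have shifted := (hasSum_choose_mul_pow hy (r - h)).mul_left (Ring.choose r h * x ^ h)
  rw [← sqrt_mul_coeff_halfPow k h x (one_add_ne_zero_of_norm_lt_one hy)] at shifted
  have initial : ∑ n ∈ range h, Ring.choose r n * x ^ n
      * coeff h (expandAt α (Polynomial.X ^ n)) = 0 := sum_eq_zero fun n hn => by
    rw [coeff_expandAt_X_pow, Nat.choose_eq_zero_of_lt (mem_range.1 hn)]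
    simp
  have terms (n : ℕ) : Ring.choose r (n + h) * x ^ (n + h)
      * coeff h (expandAt α (Polynomial.X ^ (n + h)))
      = Ring.choose r h * x ^ h * (Ring.choose (r - h) n * (α * x) ^ n) := by
    have absorption := Ring.choose_smul_choose r (Nat.le_add_left h n)
    rw [Nat.add_sub_cancel, nsmul_eq_mul] at absorption
    rw [coeff_expandAt_X_pow, Nat.add_sub_cancel, pow_add, mul_pow]
    linear_combination x ^ n * x ^ h * α ^ n * absorption
  rw [← hasSum_nat_add_iff' h, initial, sub_zero]
  simpa only [terms] using shifted

variable {ι : Type*} [Fintype ι] [DecidableEq ι]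

lemma hasSum_residue {a : ι → ℂ} {x : ℂ} {j : ι} (hx : ‖a j * x‖ < 1) (k g : ℕ) :
    HasSum (fun n : ℕ => Ring.choose ((k : ℂ) + 1 / 2) n * x ^ n
        * residue a (fun _ => k + 1) j (Polynomial.X ^ (n + g)))
      ((1 + a j * x) ^ (1 / 2 : ℂ) * padeForm a x k j (Polynomial.X ^ g)) := by
  set Y : ℂ⟦X⟧ := (∏ l ∈ univ.erase j, (C (a j - a l) + X)⁻¹ ^ (k + 1))
    * expandAt (a j) (Polynomial.X ^ g)
  have form_eq : padeForm a x k j (Polynomial.X ^ g)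
      = ∑ p ∈ antidiagonal k, coeff p.1 (halfPow k x (1 + a j * x)) * coeff p.2 Y := by
    rw [padeForm_apply, mul_assoc, coeff_mul]
  have residue_eq : ∀ n, residue a (fun _ => k + 1) j (Polynomial.X ^ (n + g))
      = ∑ p ∈ antidiagonal k, coeff p.1 (expandAt (a j) (Polynomial.X ^ n)) * coeff p.2 Y := by
    intro n
    rw [residue_apply, mul_assoc, coeff_succ_X_mul, pow_add, map_mul (expandAt _), mul_left_comm,
      coeff_mul]
  simp only [form_eq, residue_eq, mul_sum, ← mul_assoc]
  exact hasSum_sum fun p _ =>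
    (hasSum_choose_mul_coeff_expandAt hx k p.1).mul_right (coeff p.2 Y)

lemma hasSum_sumResidues {a : ι → ℂ} {x : ℂ} (hx : ∀ j, ‖a j * x‖ < 1) (k g : ℕ) :
    HasSum (fun n : ℕ => Ring.choose ((k : ℂ) + 1 / 2) n * x ^ n
        * sumResidues a (fun _ => k + 1) (Polynomial.X ^ (n + g)))
      (∑ j, (1 + a j * x) ^ (1 / 2 : ℂ) * padeForm a x k j (Polynomial.X ^ g)) := by
  simp only [sumResidues_apply, mul_sum]
  exact hasSum_sum fun j _ => hasSum_residue (hx j) k g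

/-- All terms of the expansion in `x` below order `d - g` vanish, since the rational functions
`z ^ (n + g) / ∏ l, (z - a l) ^ (k + 1)` have no residue at infinity. -/
lemma norm_sum_padeForm_le {a : ι → ℂ} (ha : Function.Injective a) {M : ℝ}
    (hM : ∀ i, ‖a i‖ ≤ M) {x : ℂ} (hx : M * ‖x‖ < 1) {k d g : ℕ}
    (hd : Fintype.card ι * (k + 1) = d + 1) (hg : g ≤ d) :
    ‖∑ j, (1 + a j * x) ^ (1 / 2 : ℂ) * padeForm a x k j (Polynomial.X ^ g)‖
      ≤ 2 ^ (k + 1) * ‖x‖ ^ (d - g) * (1 / (1 - M * ‖x‖) ^ (d + 1)) := by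
  obtain ⟨i⟩ : Nonempty ι := Fintype.card_pos_iff.1 (Nat.pos_of_ne_zero fun h => by simp [h] at hd)
  have M_nonneg : 0 ≤ M := (norm_nonneg _).trans (hM i)
  have small : ∀ j, ‖a j * x‖ < 1 := fun j => by
    rw [norm_mul]
    exact (mul_le_mul_of_nonneg_right (hM j) (norm_nonneg x)).trans_lt hx
  set bound : ℕ → ℝ := fun n => 2 ^ (k + 1) * ‖x‖ ^ n
    * ((n + g).choose d * M ^ (n + g - d))
  have initial : ∑ n ∈ range (d - g), bound n = 0 := sum_eq_zero fun n hn => by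
    simp [bound, Nat.choose_eq_zero_of_lt (Nat.add_lt_of_lt_sub (mem_range.1 hn))]
  have geometric := (hasSum_choose_mul_geometric_of_norm_lt_one d (r := M * ‖x‖)
    (by rwa [Real.norm_of_nonneg (by positivity)])).mul_left (2 ^ (k + 1) * ‖x‖ ^ (d - g))
  have bound_hasSum : HasSum bound
      (2 ^ (k + 1) * ‖x‖ ^ (d - g) * (1 / (1 - M * ‖x‖) ^ (d + 1))) := by
    have terms (n : ℕ) : bound (n + (d - g))
        = 2 ^ (k + 1) * ‖x‖ ^ (d - g) * ((n + d).choose d * (M * ‖x‖) ^ n) := by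
      simp only [bound]
      rw [add_assoc, Nat.sub_add_cancel hg, Nat.add_sub_cancel, pow_add, mul_pow]
      ring
    rw [← hasSum_nat_add_iff' (d - g), initial, sub_zero]
    simpa only [terms] using geometric
  refine (hasSum_sumResidues small k g).norm_le_of_bounded bound_hasSum fun n => ?_
  rw [norm_mul, norm_mul, norm_pow]
  exact mul_le_mul (mul_le_mul_of_nonneg_right (norm_choose_add_half_le k n) (by positivity))
    (norm_sumResidues_X_pow_le ha hM _ (by simpa using hd)) (norm_nonneg _) (by positivity)

end Smallness

section ThreeNodes

variable {R : Subring ℂ}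

/-- The coefficients of `f` up to order `n` lie in `R` and are bounded by `B`. -/
def CoeffsBounded (R : Subring ℂ) (n : ℕ) (B : ℝ) (f : ℂ⟦X⟧) : Prop :=
  ∀ i ≤ n, coeff i f ∈ R ∧ ‖coeff i f‖ ≤ B

lemma CoeffsBounded.mul {n : ℕ} {A B : ℝ} {f g : ℂ⟦X⟧} (hf : CoeffsBounded R n A f)
    (hg : CoeffsBounded R n B g) : CoeffsBounded R n (2 ^ n * (A * B)) (f * g) := by
  intro i hi
  have A_nonneg : 0 ≤ A := (norm_nonneg _).trans (hf i hi).2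
  have B_nonneg : 0 ≤ B := (norm_nonneg _).trans (hg i hi).2
  have le_left : ∀ p ∈ antidiagonal i, p.1 ≤ n := fun p hp =>
    (HasAntidiagonal.antidiagonal.fst_le hp).trans hi
  have le_right : ∀ p ∈ antidiagonal i, p.2 ≤ n := fun p hp =>
    (HasAntidiagonal.antidiagonal.snd_le hp).trans hi
  rw [coeff_mul]
  refine ⟨sum_mem fun p hp => mul_mem (hf _ (le_left p hp)).1 (hg _ (le_right p hp)).1, ?_⟩
  have card_le : i + 1 ≤ 2 ^ n :=
    Nat.lt_two_pow_self.trans_le (Nat.pow_le_pow_right two_pos hi)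
  calc ‖∑ p ∈ antidiagonal i, coeff p.1 f * coeff p.2 g‖
      ≤ ∑ _p ∈ antidiagonal i, A * B := norm_sum_le_of_le _ fun p hp => by
        rw [norm_mul]
        exact mul_le_mul (hf _ (le_left p hp)).2 (hg _ (le_right p hp)).2 (norm_nonneg _) A_nonneg
    _ = (i + 1 : ℕ) * (A * B) := by rw [sum_const, Nat.card_antidiagonal, nsmul_eq_mul]
    _ ≤ 2 ^ n * (A * B) :=
        mul_le_mul_of_nonneg_right (by exact_mod_cast card_le) (mul_nonneg A_nonneg B_nonneg)

lemma pow_norm_le_pow {z : ℂ} {μ : ℝ} (hμ : 1 ≤ μ) (hz : ‖z‖ ≤ μ) {m n : ℕ} (hmn : m ≤ n) :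
    ‖z‖ ^ m ≤ μ ^ n :=
  (pow_le_pow_left₀ (norm_nonneg z) hz m).trans (pow_le_pow_right₀ hμ hmn)

lemma coeffsBounded_halfPow {N α : ℂ} (hN : N ∈ R) (hα : α ∈ R) {μ : ℝ} (hμ : 1 ≤ μ)
    (hαμ : ‖α‖ ≤ μ) (hN0 : N ≠ 0) (k : ℕ) :
    CoeffsBounded R k (4 ^ k * 2 ^ (k + 1) * (‖N‖ + μ) ^ k)
      (C (4 ^ k * N ^ k) * halfPow k N⁻¹ (1 + α * N⁻¹)) := by
  intro i hi
  obtain ⟨c, rfl⟩ := Nat.exists_eq_add_of_le hi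
  have coeff_eq : coeff i (C (4 ^ (i + c) * N ^ (i + c))
      * halfPow (i + c) N⁻¹ (1 + α * N⁻¹))
      = 4 ^ (i + c) * Ring.choose (((i + c : ℕ) : ℂ) + 1 / 2) i * (N + α) ^ c := by
    have factor : 1 + α * N⁻¹ = (N + α) * N⁻¹ := by field_simp
    have cancel : N ^ (i + c) * (N⁻¹ ^ i * N⁻¹ ^ c) = 1 := by
      rw [← pow_add, ← mul_pow, mul_inv_cancel₀ hN0, one_pow]
    rw [coeff_C_mul, halfPow, coeff_mk, factor,
      show ((i + c : ℕ) : ℤ) - i = c by push_cast; ring, zpow_natCast, mul_pow]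
    linear_combination 4 ^ (i + c) * Ring.choose (((i + c : ℕ) : ℂ) + 1 / 2) i
      * (N + α) ^ c * cancel
  rw [coeff_eq]
  constructor
  · obtain ⟨z, hz⟩ := exists_int_four_pow_mul_choose_add_half (F := ℂ) (i + c) i
    rw [pow_add, mul_comm (4 ^ i), mul_assoc (4 ^ c), hz]
    exact mul_mem (mul_mem (pow_mem (ofNat_mem R 4) c) (intCast_mem R z))
      (pow_mem (add_mem hN hα) c)
  · have sum_le : ‖N + α‖ ≤ ‖N‖ + μ := (norm_add_le _ _).trans (by gcongr)
    have power_le := pow_norm_le_pow (hμ.trans (le_add_of_nonneg_left (norm_nonneg N))) sum_le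
      (Nat.le_add_left c i)
    have choose_le := norm_choose_add_half_le (i + c) i
    simp only [norm_mul, norm_pow, RCLike.norm_ofNat]
    gcongr

lemma coeffsBounded_expandAt_X_pow {α : ℂ} (hα : α ∈ R) {μ : ℝ} (hμ : 1 ≤ μ) (hαμ : ‖α‖ ≤ μ)
    {g : ℕ} (hg : g ≤ 2) (k : ℕ) :
    CoeffsBounded R k (2 * μ ^ 2) (expandAt α (Polynomial.X ^ g)) := by
  intro i _
  have choose_le : g.choose i ≤ 2 := (Nat.choose_le_middle i g).trans (by decide +revert)
  rw [coeff_expandAt_X_pow]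
  refine ⟨mul_mem (natCast_mem R _) (pow_mem hα _), ?_⟩
  rw [norm_mul, norm_pow, Complex.norm_natCast]
  exact mul_le_mul (by exact_mod_cast choose_le) (pow_norm_le_pow hμ hαμ (by omega))
    (by positivity) two_pos.le

lemma coeffsBounded_inv_pow {δ : ℂ} (hδ : δ ∈ R) (hδ0 : δ ≠ 0) {μ : ℝ} (hμ : 1 ≤ μ)
    (hδμ : ‖δ‖ ≤ μ) (k : ℕ) :
    CoeffsBounded R k (4 ^ k * μ ^ k) (C (δ ^ (2 * k + 1)) * (C δ + X)⁻¹ ^ (k + 1)) := by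
  intro i hi
  have coeff_eq : coeff i (C (δ ^ (2 * k + 1)) * (C δ + X)⁻¹ ^ (k + 1))
      = (-1) ^ i * ((k + i).choose k) * δ ^ (k - i) := by
    rw [coeff_C_mul, coeff_inv_C_add_X_pow_succ hδ0, mul_div_assoc',
      div_eq_iff (pow_ne_zero _ hδ0), mul_assoc _ (δ ^ (k - i)), ← pow_add,
      show k - i + (k + 1 + i) = 2 * k + 1 by omega, mul_comm]
  have choose_le : (k + i).choose k ≤ 4 ^ k := calc
    (k + i).choose k ≤ 2 ^ (k + i) := Nat.choose_le_two_pow _ _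
    _ ≤ 2 ^ (2 * k) := Nat.pow_le_pow_right two_pos (by omega)
    _ = 4 ^ k := pow_mul 2 2 k
  rw [coeff_eq]
  refine ⟨mul_mem (mul_mem (pow_mem (neg_mem (one_mem R)) _) (natCast_mem R _))
    (pow_mem hδ _), ?_⟩
  simp only [norm_mul, norm_pow, norm_neg, norm_one, one_pow, one_mul, Complex.norm_natCast]
  exact mul_le_mul (by exact_mod_cast choose_le) (pow_norm_le_pow hμ hδμ (Nat.sub_le k i))
    (by positivity) (by positivity)

lemma prod_univ_erase_fin_three {M : Type*} [CommMonoid M] (j : Fin 3) (f : Fin 3 → M) :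
    ∏ l ∈ univ.erase j, f l = f (j + 1) * f (j + 2) := by
  have erase_eq : univ.erase j = {j + 1, j + 2} := by decide +revert
  rw [erase_eq, prod_pair (by decide +revert)]

/-- The product of the differences of three nodes; its square is their discriminant. -/
def nodeDisc (a : Fin 3 → ℂ) : ℂ := (a 0 - a 1) * (a 1 - a 2) * (a 2 - a 0)

lemma nodeDisc_eq (a : Fin 3 → ℂ) (j : Fin 3) :
    nodeDisc a = -((a j - a (j + 1)) * (a j - a (j + 2)) * (a (j + 1) - a (j + 2))) := by
  fin_cases j <;> simp [nodeDisc] <;> ring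

lemma nodeDisc_ne_zero {a : Fin 3 → ℂ} (ha : Function.Injective a) : nodeDisc a ≠ 0 := by
  have sub_ne (i l : Fin 3) (h : i ≠ l) : a i - a l ≠ 0 := sub_ne_zero.2 (ha.ne h)
  exact mul_ne_zero (mul_ne_zero (sub_ne _ _ (by decide)) (sub_ne _ _ (by decide)))
    (sub_ne _ _ (by decide))

/-- The factor by which Padé forms on three nodes with `x = N⁻¹` are multiplied to make them
integral. -/
def padeScale (a : Fin 3 → ℂ) (N : ℂ) (k : ℕ) : ℂ :=
  4 ^ k * nodeDisc a ^ (2 * k + 1) * N ^ k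

lemma padeScale_ne_zero {a : Fin 3 → ℂ} (ha : Function.Injective a) {N : ℂ} (hN : N ≠ 0)
    (k : ℕ) : padeScale a N k ≠ 0 :=
  mul_ne_zero (mul_ne_zero (by norm_num) (pow_ne_zero _ (nodeDisc_ne_zero ha)))
    (pow_ne_zero _ hN)

lemma padeScale_mul_padeForm_eq (a : Fin 3 → ℂ) (N : ℂ) (k g : ℕ) (j : Fin 3) :
    padeScale a N k * padeForm a N⁻¹ k j (Polynomial.X ^ g)
      = -(a (j + 1) - a (j + 2)) ^ (2 * k + 1)
        * coeff k (C (4 ^ k * N ^ k) * halfPow k N⁻¹ (1 + a j * N⁻¹)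
          * (C ((a j - a (j + 1)) ^ (2 * k + 1)) * (C (a j - a (j + 1)) + X)⁻¹ ^ (k + 1))
          * (C ((a j - a (j + 2)) ^ (2 * k + 1)) * (C (a j - a (j + 2)) + X)⁻¹ ^ (k + 1))
          * expandAt (a j) (Polynomial.X ^ g)) := by
  have odd_power : (-1 : ℂ) ^ (2 * k + 1) = -1 := Odd.neg_one_pow ⟨k, rfl⟩
  rw [padeForm_apply, prod_univ_erase_fin_three, padeScale, nodeDisc_eq a j, neg_pow, odd_power,
    mul_pow, mul_pow]
  simp only [← coeff_C_mul]
  congr 1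
  simp only [map_mul, map_neg, map_one]
  ring

lemma padeScale_mul_padeForm_mem_and_norm_le {a : Fin 3 → ℂ} (haR : ∀ i, a i ∈ R)
    (ha : Function.Injective a) {μ : ℝ} (hμ : 1 ≤ μ) (haμ : ∀ i, ‖a i‖ ≤ μ)
    (hdμ : ∀ i j, ‖a i - a j‖ ≤ μ) {N : ℂ} (hNR : N ∈ R) (hN : N ≠ 0) (k : ℕ) {g : ℕ}
    (hg : g ≤ 2) (j : Fin 3) :
    padeScale a N k * padeForm a N⁻¹ k j (Polynomial.X ^ g) ∈ R
      ∧ ‖padeScale a N k * padeForm a N⁻¹ k j (Polynomial.X ^ g)‖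
        ≤ 4 * μ ^ 3 * (1024 * μ ^ 4 * (‖N‖ + μ)) ^ k := by
  have ne_next : ∀ j : Fin 3, j ≠ j + 1 ∧ j ≠ j + 2 := by decide
  have sub_ne (l : Fin 3) (hl : j ≠ l) : a j - a l ≠ 0 := sub_ne_zero.2 (ha.ne hl)
  have bounded := (((coeffsBounded_halfPow hNR (haR j) hμ (haμ j) hN k).mul
    (coeffsBounded_inv_pow (sub_mem (haR j) (haR (j + 1))) (sub_ne _ (ne_next j).1) hμ
      (hdμ _ _) k)).mul
    (coeffsBounded_inv_pow (sub_mem (haR j) (haR (j + 2))) (sub_ne _ (ne_next j).2) hμ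
      (hdμ _ _) k)).mul
    (coeffsBounded_expandAt_X_pow (haR j) hμ (haμ j) hg k) k le_rfl
  rw [padeScale_mul_padeForm_eq]
  refine ⟨mul_mem (neg_mem (pow_mem (sub_mem (haR _) (haR _)) _)) bounded.1, ?_⟩
  rw [norm_mul, norm_neg, norm_pow]
  refine (mul_le_mul (pow_norm_le_pow hμ (hdμ _ _) le_rfl) bounded.2 (norm_nonneg _)
    (by positivity)).trans_eq ?_
  rw [show (1024 : ℝ) = 2 * 2 * 2 * 4 * 2 * 4 * 4 by norm_num]
  simp only [mul_pow]
  ring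

end ThreeNodes

section Approximation

lemma norm_padeScale_mul_sum_le {a : Fin 3 → ℂ} (ha : Function.Injective a) {μ : ℝ}
    (hμ : 1 ≤ μ) (haμ : ∀ i, ‖a i‖ ≤ μ) {N : ℂ} (hNμ : 100 * μ ≤ ‖N‖) (k : ℕ) {g : ℕ}
    (hg : g ≤ 2) :
    ‖padeScale a N k
        * ∑ j, (1 + a j * N⁻¹) ^ (1 / 2 : ℂ) * padeForm a N⁻¹ k j (Polynomial.X ^ g)‖
      ≤ 4 * ‖nodeDisc a‖ * (16 * ‖nodeDisc a‖ ^ 2 / ‖N‖ ^ 2) ^ k := by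
  have one_le_N : 1 ≤ ‖N‖ := by linarith
  have N_pos : 0 < ‖N‖ := by linarith
  have small : μ * ‖N⁻¹‖ ≤ 1 / 100 := by
    rw [norm_inv, ← div_eq_mul_inv, div_le_iff₀ N_pos]
    linarith
  have forms_le := norm_sum_padeForm_le ha haμ (x := N⁻¹) (k := k) (d := 3 * k + 2) (g := g)
    (by linarith) (by rw [Fintype.card_fin]; ring) (by omega)
  have power_le : ‖N⁻¹‖ ^ (3 * k + 2 - g) ≤ (‖N‖ ^ (3 * k))⁻¹ := by
    rw [norm_inv, ← inv_pow]
    exact pow_le_pow_of_le_one (by positivity) (inv_le_one_of_one_le₀ one_le_N) (by omega)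
  have geometric_le : 1 / (1 - μ * ‖N⁻¹‖) ^ (3 * k + 2 + 1) ≤ 2 ^ (k + 1) := by
    have cube_le : (99 / 100 : ℝ) ^ 3 ≤ (1 - μ * ‖N⁻¹‖) ^ 3 := by gcongr; linarith
    rw [show 3 * k + 2 + 1 = 3 * (k + 1) by ring, pow_mul, ← one_div_pow]
    gcongr
    rw [div_le_iff₀ (by linarith)]
    linarith
  rw [norm_mul, padeScale, norm_mul, norm_mul, norm_pow, norm_pow, norm_pow, RCLike.norm_ofNat]
  calc _ ≤ 4 ^ k * ‖nodeDisc a‖ ^ (2 * k + 1) * ‖N‖ ^ k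
        * (2 ^ (k + 1) * (‖N‖ ^ (3 * k))⁻¹ * 2 ^ (k + 1)) := by
        refine mul_le_mul_of_nonneg_left (forms_le.trans ?_) (by positivity)
        exact mul_le_mul (mul_le_mul_of_nonneg_left power_le (by positivity)) geometric_le
          (one_div_nonneg.2 (pow_nonneg (by linarith) _)) (by positivity)
    _ = _ := by
        rw [show (16 : ℝ) = 4 * 2 * 2 by norm_num, show 3 * k = k + 2 * k by ring]
        simp only [div_pow, mul_pow, ← pow_mul, pow_add]
        field_simp
        norm_num

/-- Pairing `v` with suitable Padé forms gives a nonzero element of `R`, hence one of norm at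
least `1`; subtracting the multiple `w` of the small linear form bounds it from above. -/
theorem one_le_pade_bound {R : Subring ℂ} (hR : IsOneSeparated R) {a : Fin 3 → ℂ}
    (haR : ∀ i, a i ∈ R) (ha : Function.Injective a) {μ : ℝ} (hμ : 1 ≤ μ)
    (haμ : ∀ i, ‖a i‖ ≤ μ) (hdμ : ∀ i j, ‖a i - a j‖ ≤ μ) {N : ℂ} (hNR : N ∈ R)
    (hNμ : 100 * μ ≤ ‖N‖) {v : Fin 3 → ℂ} (hvR : ∀ i, v i ∈ R) (hv : v ≠ 0) (w : ℂ) (k : ℕ) :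
    1 ≤ 4 * μ ^ 3 * (1024 * μ ^ 4 * (‖N‖ + μ)) ^ k
        * ∑ j, ‖v j - w * (1 + a j * N⁻¹) ^ (1 / 2 : ℂ)‖
      + ‖w‖ * (4 * ‖nodeDisc a‖ * (16 * ‖nodeDisc a‖ ^ 2 / ‖N‖ ^ 2) ^ k) := by
  have N_pos : 0 < ‖N‖ := by linarith
  have N_ne : N ≠ 0 := norm_pos_iff.1 N_pos
  have root_ne (j : Fin 3) : 1 + a j * N⁻¹ ≠ 0 := one_add_ne_zero_of_norm_lt_one (by
    rw [norm_mul, norm_inv, ← div_eq_mul_inv, div_lt_one N_pos]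
    linarith [haμ j])
  obtain ⟨g, hg, form_ne⟩ : ∃ g ≤ 2, ∑ j, v j * padeForm a N⁻¹ k j (Polynomial.X ^ g) ≠ 0 := by
    by_contra! vanish
    exact hv (eq_zero_of_sum_padeForm_eq_zero ha (inv_ne_zero N_ne) root_ne k fun g hg =>
      vanish g (Nat.le_of_lt_succ (by simpa using hg)))
  set P : Fin 3 → ℂ := fun j => padeScale a N k * padeForm a N⁻¹ k j (Polynomial.X ^ g)
  set θ : Fin 3 → ℂ := fun j => (1 + a j * N⁻¹) ^ (1 / 2 : ℂ)
  have P_mem (j : Fin 3) := padeScale_mul_padeForm_mem_and_norm_le haR ha hμ haμ hdμ hNR N_ne k hg j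
  have sum_mul_P (u : Fin 3 → ℂ) : ∑ j, u j * P j
      = padeScale a N k * ∑ j, u j * padeForm a N⁻¹ k j (Polynomial.X ^ g) := by
    simp only [P, mul_sum, mul_left_comm]
  have one_le : 1 ≤ ‖∑ j, v j * P j‖ := by
    refine hR _ (sum_mem fun j _ => mul_mem (hvR j) (P_mem j).1) ?_
    rw [sum_mul_P]
    exact mul_ne_zero (padeScale_ne_zero ha N_ne k) form_ne
  have split : ∑ j, v j * P j = ∑ j, P j * (v j - w * θ j) + w * ∑ j, θ j * P j := by
    rw [mul_sum, ← sum_add_distrib]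
    exact sum_congr rfl fun j _ => by ring
  calc (1 : ℝ) ≤ ‖∑ j, P j * (v j - w * θ j) + w * ∑ j, θ j * P j‖ := split ▸ one_le
    _ ≤ ∑ j, ‖P j‖ * ‖v j - w * θ j‖ + ‖w‖ * ‖∑ j, θ j * P j‖ := by
      rw [← norm_mul w]
      exact (norm_add_le _ _).trans (add_le_add_left
        ((norm_sum_le _ _).trans_eq (sum_congr rfl fun j _ => norm_mul _ _)) _)
    _ ≤ _ := by
      rw [mul_sum, sum_mul_P]
      gcongr with j
      · exact (P_mem j).2
      · exact norm_padeScale_mul_sum_le ha hμ haμ hNμ k hg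

end Approximation

end HermitePade

/-! ### Gap principle -/

namespace IsDiophantineTuple

variable {R S : Type*} [CommRing R] [CommRing S] {n : R} {m : ℕ} {a : Fin m → R}

lemma isSquare_of_ne (h : IsDiophantineTuple n a) {i j : Fin m} (hij : i ≠ j) :
    IsSquare (a i * a j + n) := by
  rcases hij.lt_or_gt with lt | gt
  · exact h.isSquare i j lt
  · rw [mul_comm]
    exact h.isSquare j i gt

lemma comp (h : IsDiophantineTuple n a) {l : ℕ} {f : Fin l → Fin m}
    (hf : Function.Injective f) : IsDiophantineTuple n (a ∘ f) where
  injective := h.injective.comp hf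
  ne_zero i := h.ne_zero (f i)
  isSquare _ _ hij := h.isSquare_of_ne (hf.ne hij.ne)

lemma map (h : IsDiophantineTuple n a) {φ : R →+* S} (hφ : Function.Injective φ) :
    IsDiophantineTuple (φ n) (φ ∘ a) where
  injective := hφ.comp h.injective
  ne_zero i := (map_ne_zero_iff φ hφ).2 (h.ne_zero i)
  isSquare i j hij := by simpa using (h.isSquare i j hij).map φ

lemma exists_mul_sub_one_eq_sq (h : IsDiophantineTuple (-1) a) {i j : Fin m} (hij : i ≠ j) :
    ∃ r, a i * a j - 1 = r ^ 2 := by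
  obtain ⟨r, hr⟩ := h.isSquare_of_ne hij
  exact ⟨r, by rw [sub_eq_add_neg, hr, sq]⟩

end IsDiophantineTuple

section GapPrinciple

/-- The symmetric form that vanishes exactly when `c = a + b ± 2r` with `r ^ 2 = a * b - 1`, that
is, on the triples with property `D(-1)` called regular. -/
def regularForm (a b c : ℂ) : ℂ :=
  a ^ 2 + b ^ 2 + c ^ 2 - 2 * a * b - 2 * b * c - 2 * c * a + 4

lemma norm_regularForm_le (a b c : ℂ) :
    ‖regularForm a b c‖ ≤ 2 * (‖a‖ ^ 2 + ‖b‖ ^ 2 + ‖c‖ ^ 2) + 4 := by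
  have split : regularForm a b c = c ^ 2 + (-2 * (c * (a + b))) + (a - b) ^ 2 + 4 := by
    rw [regularForm]
    ring
  have triangle : ‖regularForm a b c‖ ≤ ‖c‖ ^ 2 + 2 * (‖c‖ * ‖a + b‖) + ‖a - b‖ ^ 2 + 4 := by
    rw [split]
    refine (norm_add_le _ _).trans (add_le_add (norm_add₃_le.trans_eq ?_) (by simp))
    simp only [norm_pow, norm_mul, norm_neg, RCLike.norm_ofNat]
  have parallelogram := parallelogram_law_with_norm ℝ a b
  linarith [two_mul_le_add_sq ‖c‖ ‖a + b‖]

/-- With `P = 2abc - (a + b + c)` and `r`, `s`, `t` the roots of `ab - 1`, `ac - 1`, `bc - 1`, the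
form factors as `(P + 2rst) * (P - 2rst)`; both factors have norm at least `1`, so neither of them
can be large. -/
lemma four_mul_norm_le_of_regularForm_ne_zero {R : Subring ℂ} (hR : IsOneSeparated R)
    {a b c r s t : R} (hab : a * b - 1 = r ^ 2) (hac : a * c - 1 = s ^ 2)
    (hbc : b * c - 1 = t ^ 2) (hreg : regularForm a b c ≠ 0) :
    4 * (‖(a : ℂ)‖ * ‖(b : ℂ)‖ * ‖(c : ℂ)‖)
      ≤ 2 * (‖(a : ℂ)‖ ^ 2 + ‖(b : ℂ)‖ ^ 2 + ‖(c : ℂ)‖ ^ 2)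
        + 2 * (‖(a : ℂ)‖ + ‖(b : ℂ)‖ + ‖(c : ℂ)‖) + 5 := by
  set e₁ : R := 2 * a * b * c - (a + b + c) + 2 * r * s * t with he₁
  set e₂ : R := 2 * a * b * c - (a + b + c) - 2 * r * s * t with he₂
  have factorization : (e₁ * e₂ : ℂ) = regularForm a b c := by
    have in_ring : e₁ * e₂
        = a ^ 2 + b ^ 2 + c ^ 2 - 2 * a * b - 2 * b * c - 2 * c * a + 4 := by
      have squares : e₁ * e₂
          = (2 * a * b * c - (a + b + c)) ^ 2 - 4 * r ^ 2 * s ^ 2 * t ^ 2 := by ring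
      rw [squares, ← hab, ← hac, ← hbc]
      ring
    have in_complex := congrArg R.subtype in_ring
    simp only [map_add, map_sub, map_mul, map_pow, map_ofNat] at in_complex
    exact in_complex
  have one_le₁ : 1 ≤ ‖(e₁ : ℂ)‖ := hR _ e₁.2 fun h => hreg (by rw [← factorization, h, zero_mul])
  have one_le₂ : 1 ≤ ‖(e₂ : ℂ)‖ := hR _ e₂.2 fun h => hreg (by rw [← factorization, h, mul_zero])
  have prod_le := norm_regularForm_le a b c
  rw [← factorization, norm_mul] at prod_le
  have le_sum : 4 * (‖(a : ℂ)‖ * ‖(b : ℂ)‖ * ‖(c : ℂ)‖)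
      ≤ ‖(e₁ : ℂ)‖ + ‖(e₂ : ℂ)‖ + 2 * (‖(a : ℂ)‖ + ‖(b : ℂ)‖ + ‖(c : ℂ)‖) := by
    have eq_sum : (4 * (a * b * c) : ℂ) = e₁ + e₂ + 2 * (a + b + c) := by
      simp only [he₁, he₂, ← R.subtype_apply, map_add, map_sub, map_mul, map_ofNat]
      ring
    calc _ = ‖(e₁ + e₂ + 2 * (a + b + c) : ℂ)‖ := by
          rw [← eq_sum]
          simp only [norm_mul, RCLike.norm_ofNat]
      _ ≤ ‖(e₁ : ℂ)‖ + ‖(e₂ : ℂ)‖ + ‖(2 * (a + b + c) : ℂ)‖ := norm_add₃_le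
      _ ≤ _ := by
          rw [norm_mul, RCLike.norm_ofNat]
          gcongr
          exact norm_add₃_le
  nlinarith [mul_nonneg (sub_nonneg.2 one_le₁) (sub_nonneg.2 one_le₂)]

lemma mul_le_of_gap {α β γ : ℝ} (hα0 : 0 ≤ α) (hα : 7 ≤ α ^ 2) (hαβ : α ≤ β) (hβγ : β ≤ γ)
    (h : 4 * (α * β * γ) ≤ 2 * (α ^ 2 + β ^ 2 + γ ^ 2) + 2 * (α + β + γ) + 5) : β * α ≤ γ := by
  by_contra! lt
  have α_lower : 2.6 ≤ α := by nlinarith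
  have between := mul_nonneg (sub_nonneg.2 hβγ) (sub_nonneg.2 lt.le)
  have slope_nonpos : 2 * β - 2 * (α * β) + 2 ≤ 0 := by nlinarith
  have slope_mul := mul_nonneg (sub_nonneg.2 hβγ) (neg_nonneg.2 slope_nonpos)
  have α_terms_le : 2 * α ^ 2 + 2 * α ≤ 2 * β ^ 2 + 2 * β := by nlinarith
  have main_term : 4.4 * β ^ 2 ≤ (4 * α - 6) * β ^ 2 :=
    mul_le_mul_of_nonneg_right (by linarith) (sq_nonneg β)
  nlinarith [between, slope_mul, α_terms_le, main_term]

lemma not_gap_of_le {α β γ : ℝ} (hα0 : 0 ≤ α) (hα : 7 ≤ α ^ 2) (hαβ : α ≤ β) (hβγ : β ≤ γ)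
    (hγ : γ ≤ 4.14 * β) :
    2 * (α ^ 2 + β ^ 2 + γ ^ 2) + 2 * (α + β + γ) + 5 < 4 * (α * β * γ) := by
  have α_lower : 2.6457 ≤ α := by nlinarith
  have between := mul_nonneg (sub_nonneg.2 hβγ) (sub_nonneg.2 hγ)
  rcases le_total (10.28 * β + 2 - 4 * (α * β)) 0 with slope_nonpos | slope_nonneg
  · have slope_mul := mul_nonneg (sub_nonneg.2 hβγ) (neg_nonneg.2 slope_nonpos)
    have α_terms_le : 2 * α ^ 2 + 2 * α ≤ 2 * β ^ 2 + 2 * β := by nlinarith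
    have main_term : 4.5 * β ^ 2 ≤ (4 * α - 6) * β ^ 2 :=
      mul_le_mul_of_nonneg_right (by linarith) (sq_nonneg β)
    nlinarith [between, slope_mul, α_terms_le, main_term]
  · have slope_mul := mul_nonneg (sub_nonneg.2 hγ) slope_nonneg
    have main_term : 0 ≤ (α - 2.6457) * (16.56 * β ^ 2 - 2 * (α + 2.6457) - 2) :=
      mul_nonneg (by linarith) (by nlinarith)
    nlinarith [between, slope_mul, main_term]

lemma norm_le_of_regularForm_eq_zero {b c d r : ℂ} (hbc : b * c - 1 = r ^ 2)
    (hreg : regularForm b c d = 0) (hle : ‖b‖ ≤ ‖c‖) (hc : 7 ≤ ‖c‖ ^ 2) :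
    ‖d‖ ≤ 4.14 * ‖c‖ := by
  have r_le : ‖r‖ ≤ 1.07 * ‖c‖ := by
    have sq_le : ‖r‖ ^ 2 ≤ ‖b‖ * ‖c‖ + 1 := by
      rw [← norm_pow, ← hbc, ← norm_mul]
      simpa using norm_sub_le (b * c) 1
    apply le_of_sq_le_sq _ (by positivity)
    nlinarith [norm_nonneg c]
  have factorization : (d - (b + c + 2 * r)) * (d - (b + c + -(2 * r))) = 0 := by
    rw [← hreg, regularForm]
    linear_combination (4 : ℂ) * hbc
  have sum_le : ‖b‖ + ‖c‖ + ‖2 * r‖ ≤ 4.14 * ‖c‖ := by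
    rw [norm_mul, RCLike.norm_ofNat]
    linarith
  rcases mul_eq_zero.1 factorization with eq | eq
  · rw [sub_eq_zero.1 eq]
    exact norm_add₃_le.trans sum_le
  · rw [sub_eq_zero.1 eq]
    exact norm_add₃_le.trans (by rwa [norm_neg])

lemma add_eq_of_regularForm_eq_zero {x y c d : ℂ} (hx : regularForm x c d = 0)
    (hy : regularForm y c d = 0) (hxy : x ≠ y) : x + y = 2 * c + 2 * d := by
  have factorization : (x - y) * (x + y - (2 * c + 2 * d)) = 0 := by
    rw [regularForm] at hx hy
    linear_combination hx - hy
  exact sub_eq_zero.1 ((mul_eq_zero.1 factorization).resolve_left (sub_ne_zero.2 hxy))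

/-- A regular triple `(a i, a j, a k)` would force `a k` to be so small that `(a p, a j, a k)` and
`(a q, a j, a k)` are regular too, but the form is quadratic in its first argument. -/
lemma IsDiophantineTuple.norm_mul_le {R : Subring ℂ} (hR : IsOneSeparated R) {m : ℕ}
    {a : Fin m → R} (h : IsDiophantineTuple (-1) a) (hmono : Monotone fun i => ‖(a i : ℂ)‖)
    (hseven : ∀ i, 7 ≤ ‖(a i : ℂ)‖ ^ 2) {p q i j k : Fin m} (hpq : p < q) (hqi : q < i)
    (hij : i < j) (hjk : j < k) : ‖(a j : ℂ)‖ * ‖(a i : ℂ)‖ ≤ ‖(a k : ℂ)‖ := by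
  have gap {l : Fin m} (hl : l < j) (hreg : regularForm (a l) (a j) (a k) ≠ 0) :
      4 * (‖(a l : ℂ)‖ * ‖(a j : ℂ)‖ * ‖(a k : ℂ)‖)
        ≤ 2 * (‖(a l : ℂ)‖ ^ 2 + ‖(a j : ℂ)‖ ^ 2 + ‖(a k : ℂ)‖ ^ 2)
          + 2 * (‖(a l : ℂ)‖ + ‖(a j : ℂ)‖ + ‖(a k : ℂ)‖) + 5 := by
    obtain ⟨r, hr⟩ := h.exists_mul_sub_one_eq_sq hl.ne
    obtain ⟨s, hs⟩ := h.exists_mul_sub_one_eq_sq (hl.trans hjk).ne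
    obtain ⟨t, ht⟩ := h.exists_mul_sub_one_eq_sq hjk.ne
    exact four_mul_norm_le_of_regularForm_ne_zero hR hr hs ht hreg
  refine mul_le_of_gap (norm_nonneg _) (hseven i) (hmono hij.le) (hmono hjk.le) (gap hij ?_)
  intro regular
  have k_le : ‖(a k : ℂ)‖ ≤ 4.14 * ‖(a j : ℂ)‖ := by
    obtain ⟨r, hr⟩ := h.exists_mul_sub_one_eq_sq hij.ne
    exact norm_le_of_regularForm_eq_zero (r := r) (by simpa using congrArg R.subtype hr)
      regular (hmono hij.le) (hseven j)
  have all_regular {l : Fin m} (hl : l < j) : regularForm (a l) (a j) (a k) = 0 := by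
    by_contra hreg
    exact (not_gap_of_le (norm_nonneg _) (hseven l) (hmono hl.le) (hmono hjk.le) k_le).not_ge
      (gap hl hreg)
  have ne {l l' : Fin m} (hl : l < l') : (a l : ℂ) ≠ a l' := fun eq =>
    hl.ne (h.injective (Subtype.ext eq))
  have sum_p := add_eq_of_regularForm_eq_zero (all_regular ((hpq.trans hqi).trans hij)) regular
    (ne (hpq.trans hqi))
  have sum_q := add_eq_of_regularForm_eq_zero (all_regular (hqi.trans hij)) regular (ne hqi)
  exact ne hpq (by linear_combination sum_p - sum_q)

end GapPrinciple

/-! ### Quadruples -/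

section Quadruples

open HermitePade

lemma exists_sq_eq_norm_sub_mul_le (p w : ℂ) :
    ∃ q, q ^ 2 = p ^ 2 ∧ ‖q - w‖ * ‖w‖ ≤ ‖p ^ 2 - w ^ 2‖ := by
  have factorization : ‖p ^ 2 - w ^ 2‖ = ‖p + w‖ * ‖p - w‖ := by rw [sq_sub_sq, norm_mul]
  have sum_ge : 2 * ‖w‖ ≤ ‖p + w‖ + ‖p - w‖ := by
    have := norm_sub_le (p + w) (p - w)
    rwa [add_sub_sub_cancel, ← two_mul, norm_mul, RCLike.norm_ofNat] at this
  rw [factorization]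
  rcases le_total ‖w‖ ‖p + w‖ with w_le | le_w
  · refine ⟨p, rfl, ?_⟩
    rw [mul_comm]
    gcongr
  · refine ⟨-p, neg_sq p, ?_⟩
    rw [← neg_add', norm_neg]
    gcongr
    linarith

lemma half_le_norm_of_sq_eq {θ u : ℂ} (hθ : θ ^ 2 = 1 - u) (hu : ‖u‖ ≤ 1 / 2) :
    1 / 2 ≤ ‖θ‖ := by
  have sq_ge : 1 - ‖u‖ ≤ ‖θ‖ ^ 2 := by
    rw [← norm_pow, hθ]
    simpa using norm_sub_norm_le (1 : ℂ) u
  nlinarith [norm_nonneg θ]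

lemma norm_sq_sub_sq_le {a c d s x z θ : ℂ} (ha : 1 ≤ ‖a‖) (hac : ‖a‖ ≤ ‖c‖)
    (hs : a * c - 1 = s ^ 2) (hx : a * d - 1 = x ^ 2) (hz : c * d - 1 = z ^ 2)
    (hθ : θ ^ 2 = 1 - (a * c)⁻¹) :
    ‖(s * x) ^ 2 - (a * z * θ) ^ 2‖ ≤ 4 * (‖a‖ * ‖c‖) := by
  have a_ne : a ≠ 0 := norm_pos_iff.1 (by linarith)
  have c_ne : c ≠ 0 := norm_pos_iff.1 (by linarith)
  have eq : (s * x) ^ 2 - (a * z * θ) ^ 2 = (a * c - 1) * (a - c) / c := by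
    rw [mul_pow, mul_pow, mul_pow a, hθ, ← hs, ← hx, ← hz]
    field_simp
    ring
  have first_le : ‖a * c - 1‖ ≤ 2 * (‖a‖ * ‖c‖) := by
    have := norm_sub_le (a * c) 1
    rw [norm_mul, norm_one] at this
    nlinarith
  have second_le : ‖a - c‖ ≤ 2 * ‖c‖ := (norm_sub_le _ _).trans (by linarith)
  rw [eq, norm_div, norm_mul, div_le_iff₀ (norm_pos_iff.2 c_ne)]
  calc ‖a * c - 1‖ * ‖a - c‖ ≤ 2 * (‖a‖ * ‖c‖) * (2 * ‖c‖) := by gcongr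
    _ = 4 * (‖a‖ * ‖c‖) * ‖c‖ := by ring

/-- In a triple `{a, c, d}` with property `D(-1)`, one of `± s * x / (a * z)` is a good
approximation to a root of `1 - 1 / (a * c)`. -/
lemma exists_sq_eq_norm_sub_le {a c d s x z θ : ℂ} (ha : 1 ≤ ‖a‖) (hac : ‖a‖ ≤ ‖c‖)
    (hc : 2 ≤ ‖c‖) (hs : a * c - 1 = s ^ 2) (hx : a * d - 1 = x ^ 2) (hz : c * d - 1 = z ^ 2)
    (hz0 : z ≠ 0) (hθ : θ ^ 2 = 1 - (a * c)⁻¹) :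
    ∃ q, q ^ 2 = (s * x) ^ 2 ∧ ‖q - a * z * θ‖ ≤ 8 * ‖c‖ / ‖z‖ := by
  have z_pos : 0 < ‖z‖ := norm_pos_iff.2 hz0
  have θ_ge : 1 / 2 ≤ ‖θ‖ := by
    refine half_le_norm_of_sq_eq hθ ?_
    rw [norm_inv, norm_mul, one_div]
    exact inv_anti₀ (by norm_num) (by nlinarith)
  obtain ⟨q, hq, le⟩ := exists_sq_eq_norm_sub_mul_le (s * x) (a * z * θ)
  refine ⟨q, hq, ?_⟩
  have w_ge : ‖a‖ * ‖z‖ * (1 / 2) ≤ ‖a * z * θ‖ := by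
    rw [norm_mul, norm_mul]
    gcongr
  rw [le_div_iff₀ z_pos]
  refine le_of_mul_le_mul_right ?_ (show 0 < ‖a‖ * (1 / 2) by linarith)
  calc ‖q - a * z * θ‖ * ‖z‖ * (‖a‖ * (1 / 2))
      = ‖q - a * z * θ‖ * (‖a‖ * ‖z‖ * (1 / 2)) := by ring
    _ ≤ ‖q - a * z * θ‖ * ‖a * z * θ‖ := by gcongr
    _ ≤ 4 * (‖a‖ * ‖c‖) := le.trans (norm_sq_sub_sq_le ha hac hs hx hz hθ)
    _ = 8 * ‖c‖ * (‖a‖ * (1 / 2)) := by ring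

/-- With `N = a * b * c`, the three numbers `1 + pairNodes a b j / N` are `1`, `1 - 1 / (a * c)` and
`1 - 1 / (b * c)`, whose roots are simultaneously approximated by means of a quadruple
`{a, b, c, d}` with property `D(-1)`. -/
def pairNodes (a b : ℂ) : Fin 3 → ℂ := ![0, -b, -a]

lemma pairNodes_injective {a b : ℂ} (ha : a ≠ 0) (hb : b ≠ 0) (hab : a ≠ b) :
    Function.Injective (pairNodes a b) := by
  intro i j hij
  fin_cases i <;> fin_cases j <;> simp_all [pairNodes, eq_comm]

lemma pairNodes_mem {R : Subring ℂ} {a b : ℂ} (ha : a ∈ R) (hb : b ∈ R) (j : Fin 3) :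
    pairNodes a b j ∈ R := by
  fin_cases j
  exacts [zero_mem R, neg_mem hb, neg_mem ha]

lemma norm_pairNodes_le {a b : ℂ} (hab : ‖a‖ ≤ ‖b‖) (j : Fin 3) : ‖pairNodes a b j‖ ≤ ‖b‖ := by
  fin_cases j <;> simp [pairNodes, hab]

lemma norm_nodeDisc_pairNodes_le {a b : ℂ} (hab : ‖a‖ ≤ ‖b‖) :
    ‖nodeDisc (pairNodes a b)‖ ≤ 2 * ‖a‖ * ‖b‖ ^ 2 := by
  have eq : nodeDisc (pairNodes a b) = b * (a - b) * -a := by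
    simp [nodeDisc, pairNodes, neg_add_eq_sub]
  have sub_le : ‖a - b‖ ≤ 2 * ‖b‖ := (norm_sub_le _ _).trans (by linarith)
  rw [eq, norm_mul, norm_mul, norm_neg]
  calc ‖b‖ * ‖a - b‖ * ‖a‖ ≤ ‖b‖ * (2 * ‖b‖) * ‖a‖ := by gcongr
    _ = 2 * ‖a‖ * ‖b‖ ^ 2 := by ring

lemma mem_of_sq_eq_sq {R : Subring ℂ} {p q : ℂ} (hp : p ∈ R) (h : q ^ 2 = p ^ 2) : q ∈ R := by
  rcases sq_eq_sq_iff_eq_or_eq_neg.1 h with rfl | rfl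
  exacts [hp, neg_mem hp]

variable {R : Subring ℂ}

lemma exists_norm_sub_sqrt_le {a b c d z : R} (hac : ∃ s, a * c - 1 = s ^ 2)
    (had : ∃ x, a * d - 1 = x ^ 2) (hz : c * d - 1 = z ^ 2) (hz0 : z ≠ 0)
    (ha : 1 ≤ ‖(a : ℂ)‖) (hb : b ≠ 0) (hle : ‖(a : ℂ)‖ ≤ ‖(c : ℂ)‖) (hc : 2 ≤ ‖(c : ℂ)‖) :
    ∃ q : R, ‖(q : ℂ) - a * b * z * (1 + -b * (a * b * c : ℂ)⁻¹) ^ (1 / 2 : ℂ)‖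
      ≤ 8 * ‖(b : ℂ)‖ * ‖(c : ℂ)‖ / ‖(z : ℂ)‖ := by
  obtain ⟨s, hs⟩ := hac
  obtain ⟨x, hx⟩ := had
  have a_ne : (a : ℂ) ≠ 0 := norm_pos_iff.1 (by linarith)
  have b_ne : (b : ℂ) ≠ 0 := by exact_mod_cast hb
  have c_ne : (c : ℂ) ≠ 0 := norm_pos_iff.1 (by linarith)
  set θ := (1 + -b * (a * b * c : ℂ)⁻¹) ^ (1 / 2 : ℂ) with θ_def
  have θ_sq : θ ^ 2 = 1 - (a * c : ℂ)⁻¹ := by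
    rw [θ_def, one_div, Complex.cpow_ofNat_inv_pow]
    field_simp
    ring
  obtain ⟨q, q_sq, hq⟩ := exists_sq_eq_norm_sub_le ha hle hc (by simpa using congrArg R.subtype hs)
    (by simpa using congrArg R.subtype hx) (by simpa using congrArg R.subtype hz)
    (by exact_mod_cast hz0) θ_sq
  refine ⟨b * ⟨q, mem_of_sq_eq_sq (s * x).2 q_sq⟩, ?_⟩
  calc ‖(b * q : ℂ) - a * b * z * θ‖ = ‖(b : ℂ)‖ * ‖q - a * z * θ‖ := by
        rw [← norm_mul]
        ring_nf
    _ ≤ ‖(b : ℂ)‖ * (8 * ‖(c : ℂ)‖ / ‖(z : ℂ)‖) := by gcongr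
    _ = 8 * ‖(b : ℂ)‖ * ‖(c : ℂ)‖ / ‖(z : ℂ)‖ := by ring

lemma IsDiophantineTuple.exists_simultaneous_approximation {a : Fin 4 → R}
    (h : IsDiophantineTuple (-1) a) {z : R} (hz : a 2 * a 3 - 1 = z ^ 2) (hz0 : z ≠ 0)
    (h0 : 1 ≤ ‖(a 0 : ℂ)‖) (h01 : ‖(a 0 : ℂ)‖ ≤ ‖(a 1 : ℂ)‖) (h12 : ‖(a 1 : ℂ)‖ ≤ ‖(a 2 : ℂ)‖)
    (h2 : 2 ≤ ‖(a 2 : ℂ)‖) :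
    ∃ v : Fin 3 → R, v ≠ 0 ∧ ∑ j, ‖(v j : ℂ) - a 0 * a 1 * z
        * (1 + pairNodes (a 0) (a 1) j * (a 0 * a 1 * a 2 : ℂ)⁻¹) ^ (1 / 2 : ℂ)‖
      ≤ 16 * ‖(a 1 : ℂ)‖ * ‖(a 2 : ℂ)‖ / ‖(z : ℂ)‖ := by
  obtain ⟨q₁, hq₁⟩ := exists_norm_sub_sqrt_le (b := a 1)
    (h.exists_mul_sub_one_eq_sq (by decide)) (h.exists_mul_sub_one_eq_sq (by decide)) hz hz0 h0
    (h.ne_zero 1) (h01.trans h12) h2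
  obtain ⟨q₂, hq₂⟩ := exists_norm_sub_sqrt_le (b := a 0)
    (h.exists_mul_sub_one_eq_sq (by decide)) (h.exists_mul_sub_one_eq_sq (by decide)) hz hz0
    (h0.trans h01) (h.ne_zero 0) h12 h2
  rw [mul_comm (a 1 : ℂ) (a 0)] at hq₂
  refine ⟨![a 0 * a 1 * z, q₁, q₂], fun hv => ?_, ?_⟩
  · have no_zero_divisors := congrFun hv 0
    simp [h.ne_zero, hz0] at no_zero_divisors
  · calc _ ≤ 0 + 8 * ‖(a 1 : ℂ)‖ * ‖(a 2 : ℂ)‖ / ‖(z : ℂ)‖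
          + 8 * ‖(a 0 : ℂ)‖ * ‖(a 2 : ℂ)‖ / ‖(z : ℂ)‖ := by
          rw [Fin.sum_univ_three]
          exact add_le_add_three (by simp [pairNodes]) hq₁ hq₂
      _ ≤ 0 + 8 * ‖(a 1 : ℂ)‖ * ‖(a 2 : ℂ)‖ / ‖(z : ℂ)‖
          + 8 * ‖(a 1 : ℂ)‖ * ‖(a 2 : ℂ)‖ / ‖(z : ℂ)‖ := by gcongr
      _ = _ := by ring

lemma pade_main_term_le {α β γ ζ S : ℝ} (hα : 0 ≤ α) (hαβ : α ≤ β) (hβ : 128 ≤ β)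
    (hβγ : β ≤ γ) (hζ : 0 < ζ) (hS0 : 0 ≤ S) (hS : S ≤ 16 * β * γ / ζ) (k : ℕ) :
    4 * (2 * β) ^ 3 * (1024 * (2 * β) ^ 4 * (α * β * γ + 2 * β)) ^ k * S
      ≤ β ^ 6 * γ * (β ^ 9 * γ) ^ k / ζ / 2 := by
  have γ_pos : 0 < γ := by linarith
  have base_le : 1024 * (2 * β) ^ 4 * (α * β * γ + 2 * β) ≤ β ^ 9 * γ :=
    calc _ ≤ 1024 * (2 * β) ^ 4 * (β * β * γ + β * β * γ) := by
          gcongr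
          nlinarith
      _ = 2 ^ 15 * (β ^ 6 * γ) := by ring
      _ ≤ β ^ 3 * (β ^ 6 * γ) := by
          gcongr
          nlinarith [pow_le_pow_left₀ (by norm_num) hβ 3]
      _ = _ := by ring
  calc _ ≤ 4 * (2 * β) ^ 3 * (β ^ 9 * γ) ^ k * (16 * β * γ / ζ) := by gcongr
    _ = 2 ^ 10 * (β ^ 4 * γ * (β ^ 9 * γ) ^ k / ζ / 2) := by ring
    _ ≤ β ^ 2 * (β ^ 4 * γ * (β ^ 9 * γ) ^ k / ζ / 2) := by
        gcongr
        nlinarith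
    _ = _ := by ring

lemma pade_error_term_le {α β γ ζ D : ℝ} (hα : 0 < α) (hαβ : α ≤ β) (hβ : 128 ≤ β)
    (hγ : 0 < γ) (hζ : 0 < ζ) (hD0 : 0 ≤ D) (hD : D ≤ 2 * α * β ^ 2) (k : ℕ) :
    α * β * ζ * (4 * D * (16 * D ^ 2 / (α * β * γ) ^ 2) ^ k)
      ≤ β ^ 6 * ζ * (β ^ 3 / γ ^ 2) ^ k / 2 := by
  have : 0 < β := hα.trans_le hαβ
  have base_le : 16 * D ^ 2 / (α * β * γ) ^ 2 ≤ β ^ 3 / γ ^ 2 :=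
    calc _ ≤ 16 * (2 * α * β ^ 2) ^ 2 / (α * β * γ) ^ 2 := by gcongr
      _ = 64 * β ^ 2 / γ ^ 2 := by
          field_simp
          ring
      _ ≤ β * β ^ 2 / γ ^ 2 := by
          gcongr
          linarith
      _ = _ := by ring
  calc _ ≤ β * β * ζ * (4 * (2 * β * β ^ 2) * (β ^ 3 / γ ^ 2) ^ k) := by
        have : D ≤ 2 * β * β ^ 2 := hD.trans (by gcongr)
        gcongr
    _ = 16 * (β ^ 5 * ζ * (β ^ 3 / γ ^ 2) ^ k / 2) := by ring
    _ ≤ β * (β ^ 5 * ζ * (β ^ 3 / γ ^ 2) ^ k / 2) := by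
        gcongr
        linarith
    _ = _ := by ring

lemma IsDiophantineTuple.two_le_of_quadruple {a : Fin 4 → R}
    (h : IsDiophantineTuple (-1) a) (hR : IsOneSeparated R) {z : R}
    (hz : a 2 * a 3 - 1 = z ^ 2) (hz0 : z ≠ 0)
    (h01 : ‖(a 0 : ℂ)‖ ≤ ‖(a 1 : ℂ)‖) (h1 : 128 ≤ ‖(a 1 : ℂ)‖)
    (h12 : ‖(a 1 : ℂ)‖ ≤ ‖(a 2 : ℂ)‖) (h2 : 200 ≤ ‖(a 2 : ℂ)‖) (k : ℕ) :
    2 ≤ ‖(a 1 : ℂ)‖ ^ 6 * ‖(a 2 : ℂ)‖ * (‖(a 1 : ℂ)‖ ^ 9 * ‖(a 2 : ℂ)‖) ^ k / ‖(z : ℂ)‖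
      + ‖(a 1 : ℂ)‖ ^ 6 * ‖(z : ℂ)‖ * (‖(a 1 : ℂ)‖ ^ 3 / ‖(a 2 : ℂ)‖ ^ 2) ^ k := by
  have h0 : 1 ≤ ‖(a 0 : ℂ)‖ := hR _ (a 0).2 (by exact_mod_cast h.ne_zero 0)
  have z_pos : 0 < ‖(z : ℂ)‖ := norm_pos_iff.2 (by exact_mod_cast hz0)
  obtain ⟨v, v_ne, v_le⟩ := h.exists_simultaneous_approximation hz hz0 h0 h01 h12 (by linarith)
  have N_eq : ‖(a 0 * a 1 * a 2 : ℂ)‖ = ‖(a 0 : ℂ)‖ * ‖(a 1 : ℂ)‖ * ‖(a 2 : ℂ)‖ := by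
    rw [norm_mul, norm_mul]
  have N_ge : 100 * (2 * ‖(a 1 : ℂ)‖) ≤ ‖(a 0 * a 1 * a 2 : ℂ)‖ := by
    rw [N_eq]
    nlinarith [mul_le_mul h0 h2 (by norm_num) (norm_nonneg _)]
  have bound := one_le_pade_bound hR (N := a 0 * a 1 * a 2) (μ := 2 * ‖(a 1 : ℂ)‖)
    (v := fun j => v j) (pairNodes_mem (a 0).2 (a 1).2)
    (pairNodes_injective (by exact_mod_cast h.ne_zero 0) (by exact_mod_cast h.ne_zero 1)
      fun eq => absurd (h.injective (Subtype.ext eq)) (by decide))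
    (by linarith) (fun j => (norm_pairNodes_le h01 j).trans (by linarith))
    (fun i j => (norm_sub_le _ _).trans
      (by linarith [norm_pairNodes_le h01 i, norm_pairNodes_le h01 j]))
    (a 0 * a 1 * a 2).2 N_ge (fun j => (v j).2)
    (fun hv => v_ne (funext fun j => Subtype.ext (congrFun hv j))) (a 0 * a 1 * z) k
  rw [N_eq, norm_mul, norm_mul] at bound
  have main_le := pade_main_term_le (norm_nonneg _) h01 h1 h12 z_pos
    (Finset.sum_nonneg fun _ _ => norm_nonneg _) v_le k
  have error_le := pade_error_term_le (γ := ‖(a 2 : ℂ)‖) (by linarith) h01 h1 (by linarith) z_pos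
    (norm_nonneg _) (norm_nodeDisc_pairNodes_le h01) k
  linarith

/-- The least order for which the second inequality holds; the first one survives because
`9 * log b + log c ≤ 43 / 65 * (2 * log c - 3 * log b)`. -/
lemma exists_order {b c z : ℝ} (hb : 1 < b) (hbc : b ^ 34 ≤ c) (hcz : c ^ 7 * b ^ 83 ≤ z) :
    ∃ k : ℕ, b ^ 6 * c * (b ^ 9 * c) ^ k < z ∧ b ^ 6 * z * (b ^ 3 / c ^ 2) ^ k ≤ 1 := by
  have c_pos : 0 < c := lt_of_lt_of_le (by positivity) hbc
  have z_pos : 0 < z := lt_of_lt_of_le (by positivity) hcz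
  have B_pos := Real.log_pos hb
  have C_ge := Real.log_le_log (by positivity) hbc
  have Z_ge := Real.log_le_log (by positivity) hcz
  rw [Real.log_pow] at C_ge
  rw [Real.log_mul (by positivity) (by positivity), Real.log_pow, Real.log_pow] at Z_ge
  push_cast at C_ge Z_ge
  set B := Real.log b with B_def
  set C := Real.log c with C_def
  set Z := Real.log z with Z_def
  have E_pos : 0 < 2 * C - 3 * B := by linarith
  have k_ge := Nat.le_ceil ((6 * B + Z) / (2 * C - 3 * B))
  have k_lt := Nat.ceil_lt_add_one (a := (6 * B + Z) / (2 * C - 3 * B))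
    (div_nonneg (by linarith) E_pos.le)
  set k := ⌈(6 * B + Z) / (2 * C - 3 * B)⌉₊
  rw [div_le_iff₀ E_pos] at k_ge
  rw [div_add_one E_pos.ne', lt_div_iff₀ E_pos] at k_lt
  have ratio_le : (k : ℝ) * (9 * B + C) ≤ k * (43 / 65 * (2 * C - 3 * B)) := by
    gcongr
    linarith
  refine ⟨k, ?_, ?_⟩
  · rw [← Real.log_lt_log_iff (by positivity) z_pos, Real.log_mul (by positivity) (by positivity),
      Real.log_mul (by positivity) (by positivity), Real.log_pow, Real.log_pow,
      Real.log_mul (by positivity) (by positivity), Real.log_pow, ← B_def, ← C_def, ← Z_def]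
    push_cast
    linarith
  · rw [← Real.log_nonpos_iff (by positivity), Real.log_mul (by positivity) (by positivity),
      Real.log_mul (by positivity) (by positivity), Real.log_pow, Real.log_pow,
      Real.log_div (by positivity) (by positivity), Real.log_pow, Real.log_pow, ← B_def, ← C_def,
      ← Z_def]
    push_cast
    linarith

theorem IsDiophantineTuple.norm_lt_of_quadruple (hR : IsOneSeparated R) {a : Fin 4 → R}
    (h : IsDiophantineTuple (-1) a) (h01 : ‖(a 0 : ℂ)‖ ≤ ‖(a 1 : ℂ)‖)
    (h1 : 128 ≤ ‖(a 1 : ℂ)‖) (h12 : ‖(a 1 : ℂ)‖ ^ 34 ≤ ‖(a 2 : ℂ)‖) :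
    ‖(a 3 : ℂ)‖ < ‖(a 2 : ℂ)‖ ^ 13 * ‖(a 1 : ℂ)‖ ^ 168 := by
  by_contra! a₃_ge
  set β := ‖(a 1 : ℂ)‖
  set γ := ‖(a 2 : ℂ)‖
  obtain ⟨z, hz⟩ := h.exists_mul_sub_one_eq_sq (show (2 : Fin 4) ≠ 3 by decide)
  have γ_ge : β ^ 2 ≤ γ := (pow_le_pow_right₀ (by linarith) (by norm_num)).trans h12
  have γ_ge' : 200 ≤ γ := by nlinarith
  have z_sq_ge : γ * ‖(a 3 : ℂ)‖ - 1 ≤ ‖(z : ℂ)‖ ^ 2 := by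
    have hz' : (a 2 * a 3 - 1 : ℂ) = z ^ 2 := by simpa using congrArg R.subtype hz
    rw [← norm_pow, ← hz', ← norm_mul]
    simpa using norm_sub_norm_le (a 2 * a 3 : ℂ) 1
  have z_ge : γ ^ 7 * β ^ 83 ≤ ‖(z : ℂ)‖ := by
    refine le_of_sq_le_sq (le_trans ?_ z_sq_ge) (norm_nonneg _)
    have one_le : 1 ≤ (γ ^ 7 * β ^ 83) ^ 2 := one_le_pow₀
      (one_le_mul_of_one_le_of_one_le (one_le_pow₀ (by linarith)) (one_le_pow₀ (by linarith)))
    have two_mul_le : 2 * (γ ^ 7 * β ^ 83) ^ 2 ≤ γ * ‖(a 3 : ℂ)‖ :=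
      calc _ ≤ β ^ 2 * (γ ^ 7 * β ^ 83) ^ 2 := by
            gcongr
            nlinarith
        _ = γ * (γ ^ 13 * β ^ 168) := by ring
        _ ≤ _ := by gcongr
    linarith
  have z_pos : 0 < ‖(z : ℂ)‖ := lt_of_lt_of_le (by positivity) z_ge
  obtain ⟨k, main_lt, error_le⟩ := exists_order (by linarith) h12 z_ge
  have two_le := h.two_le_of_quadruple hR hz (fun hz0 => by simp [hz0] at z_pos) h01 h1
    (by nlinarith) γ_ge' k
  linarith [(div_lt_one z_pos).2 main_lt]

end Quadruples

/-! ### Counting -/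

section LargeNorm

variable {R : Subring ℂ}

lemma IsDiophantineTuple.norm_mul_norm_succ_le (hR : IsOneSeparated R) {m : ℕ} {a : Fin m → R}
    (h : IsDiophantineTuple (-1) a) (hmono : Monotone fun i => ‖(a i : ℂ)‖)
    (hseven : ∀ i, 7 ≤ ‖(a i : ℂ)‖ ^ 2) {i : ℕ} (hi : 2 ≤ i) (him : i + 2 < m) :
    ‖(a ⟨i, by omega⟩ : ℂ)‖ * ‖(a ⟨i + 1, by omega⟩ : ℂ)‖ ≤ ‖(a ⟨i + 2, him⟩ : ℂ)‖ := by
  rw [mul_comm]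
  apply h.norm_mul_le hR hmono hseven (p := ⟨i - 2, by omega⟩) (q := ⟨i - 1, by omega⟩) <;>
    rw [Fin.mk_lt_mk] <;> omega

lemma IsDiophantineTuple.pow_fib_mul_pow_fib_le (hR : IsOneSeparated R) {m : ℕ} {a : Fin m → R}
    (h : IsDiophantineTuple (-1) a) (hmono : Monotone fun i => ‖(a i : ℂ)‖)
    (hseven : ∀ i, 7 ≤ ‖(a i : ℂ)‖ ^ 2) {i : ℕ} (hi : 2 ≤ i) (j : ℕ) (hj : i + j + 1 < m) :
    ‖(a ⟨i, by omega⟩ : ℂ)‖ ^ Nat.fib j * ‖(a ⟨i + 1, by omega⟩ : ℂ)‖ ^ Nat.fib (j + 1)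
      ≤ ‖(a ⟨i + j + 1, hj⟩ : ℂ)‖ := by
  induction j using Nat.twoStepInduction with
  | zero => simp
  | one => simpa using h.norm_mul_norm_succ_le hR hmono hseven hi hj
  | more j ih₀ ih₁ =>
    calc _ = (‖(a ⟨i, by omega⟩ : ℂ)‖ ^ Nat.fib j
            * ‖(a ⟨i + 1, by omega⟩ : ℂ)‖ ^ Nat.fib (j + 1))
          * (‖(a ⟨i, by omega⟩ : ℂ)‖ ^ Nat.fib (j + 1)
            * ‖(a ⟨i + 1, by omega⟩ : ℂ)‖ ^ Nat.fib (j + 2)) := by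
          rw [Nat.fib_add_two (n := j + 1), Nat.fib_add_two (n := j)]
          ring
      _ ≤ ‖(a ⟨i + j + 1, by omega⟩ : ℂ)‖ * ‖(a ⟨i + (j + 1) + 1, by omega⟩ : ℂ)‖ := by
          gcongr
          exacts [ih₀ (by omega), ih₁ (by omega)]
      _ ≤ _ := h.norm_mul_norm_succ_le hR hmono hseven (i := i + j + 1) (by omega) hj

/-- The elements of index `5`, `6`, `14`, `20` form a quadruple with gaps too large to exist. -/
lemma not_isDiophantineTuple_twentyOne (hR : IsOneSeparated R) {a : Fin 21 → R}
    (hmono : Monotone fun i => ‖(a i : ℂ)‖) (hseven : ∀ i, 7 ≤ ‖(a i : ℂ)‖ ^ 2) :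
    ¬ IsDiophantineTuple (-1) a := by
  intro h
  have one_le (i : Fin 21) : 1 ≤ ‖(a i : ℂ)‖ := hR _ (a i).2 (by exact_mod_cast h.ne_zero i)
  have a₆_ge : 128 ≤ ‖(a 6 : ℂ)‖ := by
    have fib_le : ‖(a 2 : ℂ)‖ ^ 2 * ‖(a 3 : ℂ)‖ ^ 3 ≤ ‖(a 6 : ℂ)‖ :=
      h.pow_fib_mul_pow_fib_le hR hmono hseven (i := 2) le_rfl 3 (by norm_num)
    refine le_of_sq_le_sq ?_ (norm_nonneg _)
    calc (128 : ℝ) ^ 2 ≤ 7 ^ 2 * 7 ^ 3 := by norm_num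
      _ ≤ (‖(a 2 : ℂ)‖ ^ 2) ^ 2 * (‖(a 3 : ℂ)‖ ^ 2) ^ 3 := by
          gcongr
          exacts [hseven 2, hseven 3]
      _ = (‖(a 2 : ℂ)‖ ^ 2 * ‖(a 3 : ℂ)‖ ^ 3) ^ 2 := by ring
      _ ≤ _ := by gcongr
  have a₁₃_ge : ‖(a 6 : ℂ)‖ ^ 21 ≤ ‖(a 13 : ℂ)‖ := by
    have fib_le : ‖(a 5 : ℂ)‖ ^ 13 * ‖(a 6 : ℂ)‖ ^ 21 ≤ ‖(a 13 : ℂ)‖ :=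
      h.pow_fib_mul_pow_fib_le hR hmono hseven (i := 5) (by norm_num) 7 (by norm_num)
    exact (le_mul_of_one_le_left (by positivity) (one_le_pow₀ (one_le 5))).trans fib_le
  have a₁₄_ge : ‖(a 6 : ℂ)‖ ^ 34 ≤ ‖(a 14 : ℂ)‖ := by
    have fib_le : ‖(a 5 : ℂ)‖ ^ 21 * ‖(a 6 : ℂ)‖ ^ 34 ≤ ‖(a 14 : ℂ)‖ :=
      h.pow_fib_mul_pow_fib_le hR hmono hseven (i := 5) (by norm_num) 8 (by norm_num)
    exact (le_mul_of_one_le_left (by positivity) (one_le_pow₀ (one_le 5))).trans fib_le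
  have a₂₀_ge : ‖(a 14 : ℂ)‖ ^ 13 * ‖(a 6 : ℂ)‖ ^ 168 ≤ ‖(a 20 : ℂ)‖ := by
    have fib_le : ‖(a 13 : ℂ)‖ ^ 8 * ‖(a 14 : ℂ)‖ ^ 13 ≤ ‖(a 20 : ℂ)‖ :=
      h.pow_fib_mul_pow_fib_le hR hmono hseven (i := 13) (by norm_num) 6 (by norm_num)
    calc _ = (‖(a 6 : ℂ)‖ ^ 21) ^ 8 * ‖(a 14 : ℂ)‖ ^ 13 := by ring
      _ ≤ ‖(a 13 : ℂ)‖ ^ 8 * ‖(a 14 : ℂ)‖ ^ 13 := by gcongr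
      _ ≤ _ := fib_le
  have quadruple : IsDiophantineTuple (-1) (a ∘ ![5, 6, 14, 20]) := h.comp (by decide)
  exact (quadruple.norm_lt_of_quadruple hR (hmono (by decide)) a₆_ge a₁₄_ge).not_ge a₂₀_ge

theorem IsDiophantineTuple.le_twenty (hR : IsOneSeparated R) {m : ℕ} {a : Fin m → R}
    (h : IsDiophantineTuple (-1) a) (hseven : ∀ i, 7 ≤ ‖(a i : ℂ)‖ ^ 2) : m ≤ 20 := by
  by_contra! lt
  set σ := Tuple.sort fun i => ‖(a i : ℂ)‖
  have sorted : Monotone ((fun i => ‖(a i : ℂ)‖) ∘ σ) := Tuple.monotone_sort _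
  exact not_isDiophantineTuple_twentyOne hR (a := a ∘ σ ∘ Fin.castLE lt)
    (sorted.comp (Fin.strictMono_castLE lt).monotone) (fun i => hseven _)
    (h.comp (σ.injective.comp (Fin.castLE_injective lt)))

end LargeNorm

/-- The rings to which the argument applies: subrings of `ℂ` such as the rings of integers of
imaginary quadratic fields, where `‖x‖ ^ 2` is the norm of `x`. -/
def HasNatNormSq (R : Subring ℂ) : Prop := ∀ x ∈ R, ∃ n : ℕ, ‖x‖ ^ 2 = n

lemma HasNatNormSq.isOneSeparated {R : Subring ℂ} (hR : HasNatNormSq R) : IsOneSeparated R := by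
  intro y hy y_ne
  obtain ⟨n, hn⟩ := hR y hy
  have n_pos : 0 < n := by
    have norm_sq_pos : 0 < ‖y‖ ^ 2 := pow_pos (norm_pos_iff.2 y_ne) 2
    exact_mod_cast hn ▸ norm_sq_pos
  rw [← one_le_sq_iff₀ (norm_nonneg y), hn]
  exact_mod_cast n_pos

section SmallNorm

variable {R : Subring ℂ}

lemma HasNatNormSq.exists_int_eq_two_mul_re (hR : HasNatNormSq R) {x : ℂ} (hx : x ∈ R) :
    ∃ t : ℤ, 2 * x.re = t := by
  obtain ⟨n, hn⟩ := hR x hx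
  obtain ⟨l, hl⟩ := hR (x + 1) (add_mem hx (one_mem R))
  refine ⟨l - n - 1, ?_⟩
  rw [Complex.sq_norm, Complex.normSq_apply] at hn hl
  simp only [Complex.add_re, Complex.add_im, Complex.one_re, Complex.one_im] at hl
  push_cast
  linear_combination hl - hn

lemma HasNatNormSq.exists_nat_eq_two_mul_im_sq (hR : HasNatNormSq R) {x : ℂ} (hx : x ∈ R) :
    ∃ e : ℕ, (2 * x.im) ^ 2 = e ∧ (e = 0 ∨ 3 ≤ e) := by
  obtain ⟨n, hn⟩ := hR x hx
  obtain ⟨t, ht⟩ := hR.exists_int_eq_two_mul_re hx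
  rw [Complex.sq_norm, Complex.normSq_apply] at hn
  have eq : (2 * x.im) ^ 2 = ((4 * n - t ^ 2 : ℤ) : ℝ) := by
    push_cast
    rw [← ht]
    linear_combination 4 * hn
  obtain ⟨e, he⟩ := Int.eq_ofNat_of_zero_le (show (0 : ℤ) ≤ 4 * n - t ^ 2 by
    exact_mod_cast eq ▸ sq_nonneg (2 * x.im))
  refine ⟨e, by rw [eq, he, Int.cast_natCast], ?_⟩
  have mod_four : t ^ 2 % 4 = 0 ∨ t ^ 2 % 4 = 1 := by
    rcases t.even_or_odd with even | odd
    · exact .inl (Int.emod_eq_zero_of_dvd (by simpa using pow_dvd_pow_of_dvd even.two_dvd 2))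
    · exact .inr (Int.sq_mod_four_eq_one_of_odd odd)
  omega

lemma HasNatNormSq.exists_forall_im_eq_int_mul (hR : HasNatNormSq R) :
    ∃ x₀ ∈ R, ∀ x ∈ R, ∃ v : ℤ, x.im = v * x₀.im := by
  set H : AddSubgroup ℝ := R.toAddSubgroup.map Complex.imAddGroupHom
  obtain ⟨b, hb⟩ := AddSubgroup.cyclic_of_isolated_zero (H := H) one_half_pos (by
    rw [Set.disjoint_left]
    rintro _ ⟨x, hx, rfl⟩ ⟨im_pos, im_lt⟩
    simp only [Complex.coe_imAddGroupHom] at im_pos im_lt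
    obtain ⟨e, he, rfl | three_le⟩ := hR.exists_nat_eq_two_mul_im_sq hx
    · simp [im_pos.ne'] at he
    · have : (3 : ℝ) ≤ (2 * x.im) ^ 2 := he ▸ by exact_mod_cast three_le
      nlinarith)
  obtain ⟨x₀, hx₀, rfl⟩ : b ∈ H := hb ▸ AddSubgroup.mem_closure_singleton_self b
  refine ⟨x₀, hx₀, fun x hx => ?_⟩
  have im_mem : x.im ∈ H := ⟨x, hx, rfl⟩
  rw [hb, AddSubgroup.mem_closure_singleton] at im_mem
  obtain ⟨v, hv⟩ := im_mem
  exact ⟨v, by rw [← hv, zsmul_eq_mul, Complex.coe_imAddGroupHom]⟩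

/-- The number `(t + v * √(-D)) / 2`, where `p = (t, v)`. -/
noncomputable def ofCoordinates (D : ℕ) (p : ℤ × ℤ) : ℂ := ⟨p.1 / 2, p.2 * √D / 2⟩

lemma four_mul_norm_ofCoordinates_sq (D : ℕ) (p : ℤ × ℤ) :
    4 * ‖ofCoordinates D p‖ ^ 2 = p.1 ^ 2 + D * p.2 ^ 2 := by
  rw [Complex.sq_norm, Complex.normSq_apply, ofCoordinates]
  linear_combination (p.2 : ℝ) ^ 2 * Real.sq_sqrt D.cast_nonneg

theorem HasNatNormSq.exists_forall_eq_ofCoordinates (hR : HasNatNormSq R) :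
    ∃ D : ℕ, 3 ≤ D ∧ ∀ x ∈ R, ∃ p, ofCoordinates D p = x := by
  suffices ∃ D : ℕ, 3 ≤ D ∧ ∀ x ∈ R, ∃ v : ℤ, 2 * x.im = v * √D by
    obtain ⟨D, hD, hv⟩ := this
    refine ⟨D, hD, fun x hx => ?_⟩
    obtain ⟨t, ht⟩ := hR.exists_int_eq_two_mul_re hx
    obtain ⟨v, hv⟩ := hv x hx
    exact ⟨(t, v), Complex.ext (by simp only [ofCoordinates]; linarith)
      (by simp only [ofCoordinates]; linarith)⟩
  obtain ⟨x₀, hx₀, generates⟩ := hR.exists_forall_im_eq_int_mul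
  obtain ⟨e, he, rfl | three_le⟩ := hR.exists_nat_eq_two_mul_im_sq hx₀
  · have im_eq_zero : x₀.im = 0 := by simpa using he
    refine ⟨3, le_rfl, fun x hx => ⟨0, ?_⟩⟩
    obtain ⟨v, hv⟩ := generates x hx
    simp [hv, im_eq_zero]
  · refine ⟨e, three_le, fun x hx => ?_⟩
    obtain ⟨v, hv⟩ := generates x hx
    have sqrt_eq : √e = |2 * x₀.im| := by rw [← he, Real.sqrt_sq_eq_abs]
    rcases abs_choice (2 * x₀.im) with pos | neg
    · refine ⟨v, ?_⟩
      rw [sqrt_eq, pos, hv]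
      ring
    · refine ⟨-v, ?_⟩
      rw [sqrt_eq, neg, hv]
      push_cast
      ring

open Finset

/-- The coordinates of the numbers `(t + v * √(-D)) / 2` whose squared absolute value is an integer
between `lo` and `hi`. The box around them is large enough for `3 ≤ D` and `hi ≤ 6` only. -/
noncomputable def coordinateBox (D lo hi : ℕ) : Finset (ℤ × ℤ) :=
  {p ∈ Icc (-4 : ℤ) 4 ×ˢ Icc (-2 : ℤ) 2 |
    4 * (lo : ℤ) ≤ p.1 ^ 2 + D * p.2 ^ 2 ∧ p.1 ^ 2 + D * p.2 ^ 2 ≤ 4 * hi ∧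
      4 ∣ p.1 ^ 2 + D * p.2 ^ 2}

lemma mem_coordinateBox {D lo hi n : ℕ} (hD : 3 ≤ D) (hhi : hi ≤ 6) {p : ℤ × ℤ}
    (hn : ‖ofCoordinates D p‖ ^ 2 = n) (hlo_n : lo ≤ n) (hn_hi : n ≤ hi) :
    p ∈ coordinateBox D lo hi := by
  have eq : p.1 ^ 2 + D * p.2 ^ 2 = 4 * n := by
    have := four_mul_norm_ofCoordinates_sq D p
    rw [hn] at this
    exact_mod_cast this.symm
  have v_le : 3 * p.2 ^ 2 ≤ D * p.2 ^ 2 := by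
    gcongr
    exact_mod_cast hD
  have fst_abs : |p.1| ≤ 4 := Int.lt_add_one_iff.1
    (abs_lt_of_sq_lt_sq (by nlinarith [sq_nonneg p.2]) (by norm_num))
  have snd_abs : |p.2| ≤ 2 := Int.lt_add_one_iff.1
    (abs_lt_of_sq_lt_sq (by nlinarith [sq_nonneg p.1]) (by norm_num))
  simp only [coordinateBox, mem_filter, mem_product, mem_Icc, eq, ← abs_le]
  exact ⟨⟨fst_abs, snd_abs⟩, by omega, by omega, dvd_mul_right 4 _⟩

lemma card_coordinateBox_le {D : ℕ} (hD : 3 ≤ D) :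
    #(coordinateBox D 2 6) ≤ 16 ∧ #(coordinateBox D 0 3) ≤ 13 := by
  rcases le_or_gt D 24 with le | gt
  · interval_cases D <;> decide +kernel
  · have card_le (lo hi : ℕ) (hhi : hi ≤ 6) : #(coordinateBox D lo hi) ≤ 9 := by
      refine (card_le_card (t := Icc (-4 : ℤ) 4 ×ˢ {0}) fun p hp => ?_).trans (by decide)
      simp only [coordinateBox, mem_filter, mem_product, mem_Icc] at hp
      obtain ⟨⟨fst_mem, -⟩, -, le, -⟩ := hp
      refine mem_product.2 ⟨mem_Icc.2 fst_mem, mem_singleton.2 ?_⟩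
      by_contra snd_ne
      have D_ge : (25 : ℤ) ≤ D := by exact_mod_cast gt
      have sq_ge : 1 ≤ p.2 ^ 2 := sq_pos_of_ne_zero snd_ne
      nlinarith [sq_nonneg p.1, mul_le_mul D_ge sq_ge zero_le_one (by positivity)]
    exact ⟨(card_le 2 6 le_rfl).trans (by norm_num),
      (card_le 0 3 (by norm_num)).trans (by norm_num)⟩

lemma card_le_card_coordinateBox (hR : HasNatNormSq R) {D : ℕ} (hD : 3 ≤ D)
    (hcoord : ∀ x ∈ R, ∃ p, ofCoordinates D p = x) {ι : Type*} [Fintype ι] {f : ι → R}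
    (hf : Function.Injective f) {lo hi : ℕ} (hhi : hi ≤ 6) (hlo_f : ∀ i, lo ≤ ‖(f i : ℂ)‖ ^ 2)
    (hf_hi : ∀ i, ‖(f i : ℂ)‖ ^ 2 ≤ hi) : Fintype.card ι ≤ #(coordinateBox D lo hi) := by
  choose p hp using fun i => hcoord (f i) (f i).2
  refine card_le_card_of_injOn p (fun i _ => ?_) fun i _ j _ hij => ?_
  · obtain ⟨n, hn⟩ := hR _ (f i).2
    have hlo := hlo_f i
    have hhi' := hf_hi i
    rw [hn] at hlo hhi'
    exact mem_coordinateBox hD hhi ((hp i).symm ▸ hn) (by exact_mod_cast hlo)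
      (by exact_mod_cast hhi')
  · exact hf (Subtype.ext (by rw [← hp i, ← hp j, hij]))

lemma IsDiophantineTuple.le_fourteen_of_norm_eq_one (hR : HasNatNormSq R) {m : ℕ} {a : Fin m → R}
    (h : IsDiophantineTuple (-1) a) (hsix : ∀ i, ‖(a i : ℂ)‖ ^ 2 ≤ 6) {i : Fin m}
    (hi : ‖(a i : ℂ)‖ = 1) : m ≤ 14 := by
  obtain ⟨D, hD, hcoord⟩ := hR.exists_forall_eq_ofCoordinates
  choose x hx using fun j : {j // j ≠ i} => h.exists_mul_sub_one_eq_sq j.2.symm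
  have x_injective : Function.Injective x := by
    intro j k hjk
    have mul_eq : a i * a j = a i * a k := by
      rw [← sub_left_inj, hx, hx, hjk]
    exact Subtype.ext (h.injective (mul_left_cancel₀ (h.ne_zero i) mul_eq))
  have norm_sq_le (j : {j // j ≠ i}) : ‖(x j : ℂ)‖ ^ 2 ≤ (3 : ℕ) := by
    obtain ⟨n, hn⟩ := hR _ (x j).2
    have le : ‖(x j : ℂ)‖ ^ 2 ≤ ‖(a j : ℂ)‖ + 1 := by
      have eq : (a i * a j - 1 : ℂ) = x j ^ 2 := by simpa using congrArg R.subtype (hx j)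
      rw [← norm_pow, ← eq]
      simpa [hi] using norm_sub_le (a i * a j : ℂ) 1
    rw [hn] at le ⊢
    have n_lt : (n : ℝ) < (4 : ℕ) := by
      push_cast
      nlinarith [hsix j, norm_nonneg (a j : ℂ)]
    exact_mod_cast Nat.le_of_lt_succ (by exact_mod_cast n_lt)
  have card_le := (card_le_card_coordinateBox hR hD hcoord x_injective (lo := 0) (by norm_num)
    (fun j => by simp) norm_sq_le).trans (card_coordinateBox_le hD).2
  rw [Fintype.card_subtype_compl, Fintype.card_fin, Fintype.card_subtype_eq] at card_le
  omega

theorem IsDiophantineTuple.le_sixteen (hR : HasNatNormSq R) {m : ℕ} {a : Fin m → R}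
    (h : IsDiophantineTuple (-1) a) (hsix : ∀ i, ‖(a i : ℂ)‖ ^ 2 ≤ 6) : m ≤ 16 := by
  by_cases hunit : ∃ i, ‖(a i : ℂ)‖ = 1
  · obtain ⟨i, hi⟩ := hunit
    exact (h.le_fourteen_of_norm_eq_one hR hsix hi).trans (by norm_num)
  · push Not at hunit
    obtain ⟨D, hD, hcoord⟩ := hR.exists_forall_eq_ofCoordinates
    have two_le (i : Fin m) : (2 : ℕ) ≤ ‖(a i : ℂ)‖ ^ 2 := by
      have one_lt : 1 < ‖(a i : ℂ)‖ ^ 2 := one_lt_pow₀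
        ((hR.isOneSeparated _ (a i).2 (by exact_mod_cast h.ne_zero i)).lt_of_ne' (hunit i))
        two_ne_zero
      obtain ⟨n, hn⟩ := hR _ (a i).2
      rw [hn] at one_lt ⊢
      exact_mod_cast one_lt
    simpa using (card_le_card_coordinateBox hR hD hcoord h.injective le_rfl two_le
      (by exact_mod_cast hsix)).trans (card_coordinateBox_le hD).1

theorem IsDiophantineTuple.le_thirtySix (hR : HasNatNormSq R) {m : ℕ} {a : Fin m → R}
    (h : IsDiophantineTuple (-1) a) : m ≤ 36 := by
  set small : Finset (Fin m) := {i | ‖(a i : ℂ)‖ ^ 2 ≤ 6} with small_def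
  have small_le : #small ≤ 16 :=
    (h.comp (small.orderEmbOfFin rfl).injective).le_sixteen hR fun i =>
      (mem_filter.1 (small.orderEmbOfFin_mem rfl i)).2
  have large_le : #smallᶜ ≤ 20 := by
    refine (h.comp (smallᶜ.orderEmbOfFin rfl).injective).le_twenty hR.isOneSeparated fun i => ?_
    have not_small := smallᶜ.orderEmbOfFin_mem rfl i
    set j := smallᶜ.orderEmbOfFin rfl i
    simp only [small_def, mem_compl, mem_filter, mem_univ, true_and, not_le] at not_small
    obtain ⟨n, hn⟩ := hR _ (a j).2
    change 7 ≤ ‖(a j : ℂ)‖ ^ 2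
    rw [hn] at not_small ⊢
    exact_mod_cast not_small
  have card_eq := card_add_card_compl small
  rw [Fintype.card_fin] at card_eq
  omega

end SmallNorm

theorem theorem1_general {R : Type*} [CommRing R] {φ : R →+* ℂ}
    (hR : HasNatNormSq φ.range) (hφ : Function.Injective φ) {m : ℕ} {a : Fin m → R}
    (h : IsDiophantineTuple (-1) a) : m ≤ 36 := by
  have range_tuple := h.map (φ := φ.rangeRestrict) fun _ _ hxy => hφ (congrArg Subtype.val hxy)
  rw [map_neg, map_one] at range_tuple
  exact range_tuple.le_thirtySix hR

section QuadraticField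

open NumberField

variable {K : Type*} [Field K] [NumberField K] [Algebra.IsQuadraticExtension ℚ K]
  [IsTotallyComplex K]

lemma card_infinitePlace_eq_one : Fintype.card (InfinitePlace K) = 1 := by
  have card_eq := InfinitePlace.card_eq_nrRealPlaces_add_nrComplexPlaces K
  have rank_eq := InfinitePlace.card_add_two_mul_card_eq_rank K
  rw [IsTotallyComplex.nrRealPlaces_eq_zero] at card_eq rank_eq
  rw [Algebra.IsQuadraticExtension.finrank_eq_two] at rank_eq
  omega

lemma norm_sq_eq_abs_algebra_norm (φ : K →+* ℂ) (x : K) : ‖φ x‖ ^ 2 = |Algebra.norm ℚ x| := by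
  have : Subsingleton (InfinitePlace K) :=
    Fintype.card_le_one_iff_subsingleton.1 card_infinitePlace_eq_one.le
  have prod_eq := InfinitePlace.prod_eq_abs_norm x
  rwa [Fintype.prod_subsingleton _ (InfinitePlace.mk φ), InfinitePlace.apply,
    InfinitePlace.mult_isComplex ⟨_, IsTotallyComplex.isComplex _⟩] at prod_eq

lemma hasNatNormSq_range_ringOfIntegers (φ : K →+* ℂ) :
    HasNatNormSq (φ.comp (algebraMap (𝓞 K) K)).range := by
  rintro _ ⟨x, rfl⟩
  refine ⟨(Algebra.norm ℤ x).natAbs, ?_⟩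
  rw [RingHom.comp_apply, norm_sq_eq_abs_algebra_norm, ← Algebra.coe_norm_int]
  simp [Nat.cast_natAbs]

end QuadraticField

theorem theorem1 (K : Type*) [Field K] [NumberField K] [Algebra.IsQuadraticExtension ℚ K]
    [NumberField.IsTotallyComplex K] (m : ℕ) (hm : 36 < m) :
    ¬ ∃ a : Fin m → NumberField.RingOfIntegers K, IsDiophantineTuple (-1) a := by
  rintro ⟨a, ha⟩
  obtain ⟨φ⟩ : Nonempty (K →+* ℂ) := inferInstance
  exact hm.not_ge (theorem1_general (hasNatNormSq_range_ringOfIntegers φ)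
    (φ.injective.comp NumberField.RingOfIntegers.coe_injective) ha)
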